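/- **Setting.** Let $\Gamma$ be an undirected graph on $n=m+u$ nodes ($m,u\ge 1$) with normalized adjacency matrix $\tilde A=(D_\Gamma+I)^{-1/2}(A+I)(D_\Gamma+I)^{-1/2}$, where $A$ and $D_\Gamma$ are its adjacency and degree matrices; node $i$ carries a feature vector $x_i\in\mathbb R^{d_0}$ (row $i$ of the matrix $X$) and a label $y_i$; write $z_i=(x_i,y_i)$. A graph neural network is built from $X$ by the operations $Z\mapsto ZW_h$ with learnable matrices $W_1,\dots,W_H$, $Z\mapsto g(\tilde A)Z$ with fixed polynomials $g$, $Z\mapsto\sum_k\gamma_k\tilde A^kZ$ with learnable coefficients $\gamma$, an entrywise activation $\sigma$, sums and multiplication by fixed scalars (this covers GCN, GCNII, SGC, APPNP and GPR-GNN). Let $w=[\mathrm{vec}\,W_1;\dots;\mathrm{vec}\,W_H]\in\mathbb R^d$, and let $\ell(w;z_i)\ge 0$ be a loss of the label $y_i$ and the output at node $i$ which is $C^2$ in the output (for instance softmax with cross-entropy). A uniformly random partition of the nodes into $m$ training and $u$ test nodes is drawn; $R_m(w)$ and $R_u(w)$ are the averages of $\ell(w;z_i)$ over the training and over the test nodes.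 SGD starts at $w^{(1)}$ and, for $t=1,\dots,T$, draws a training node $j_t$ uniformly and independently and sets $w^{(t+1)}=w^{(t)}-\eta_t\nabla\ell(w^{(t)};z_{j_t})$ with $\eta_t=\frac1{t+t_0}$. Let $r\ge1$ and $\mathcal W=\{w:\|w-w^{(1)}\|_2\le r\}$. **Assumptions.** For constants $c_X,c_W,P,G,\sigma_0>0$ and $\alpha\in(0,1]$: 1. $\|x_i\|_2\le c_X$ for all $i$; 2. $\|W_h\|\le c_W$ (spectral norm) for all $h$ and all $w\in\mathcal W$, and $w^{(1)},\dots,w^{(T+1)}\in\mathcal W$ for every outcome of the partition and of the draws; 3. $\sigma$ is differentiable and $|\sigma'(s)-\sigma'(t)|\le P|s-t|^{\alpha}$ for all $s,t\in\mathbb R$; 4. $\sqrt{\eta_t}\,\|\nabla\ell(w^{(t)};z_i)\|_2\le G$ for all nodes $i$, all $t\le T$ and every outcome; 5. $\mathbb E_{j}\|\nabla\ell(w^{(t)};z_{j})-\nabla R_m(w^{(t)})\|_2^2\le\sigma_0^2$ for all $t\le T$ and every outcome, with $j$ uniform on the training nodes; and $t_0\ge\max\{(2P)^{1/\alpha},1\}$.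 Let $L_{\mathcal F}$ be the smallest constant with $|\ell(w;z_i)-\ell(w';z_i)|\le L_{\mathcal F}\|w-w'\|_2$, and $P_{\mathcal F}$ the smallest constant with $\|\nabla\ell(w;z_i)-\nabla\ell(w';z_i)\|_2\le P_{\mathcal F}\max\{\|w-w'\|_2^{\alpha},\|w-w'\|_2\}$, for all nodes $i$ and all $w,w'\in\mathcal W$. Let $b_\ell=\max_i|\ell(w^{(1)};z_i)|$. **Theorem.** There is a constant $C$ that depends only on $\alpha$, $G$, $\sigma_0$, on upper bounds for $d$, $P_{\mathcal F}$ and $b_\ell$, and on a positive lower bound for $L_{\mathcal F}$ (so not on $m$, $u$, $T$, $\delta$, $r$, the graph or the data otherwise), such that for all $T\ge2$ and $\delta\in(0,1)$, with probability at least $1-\delta$ over the partition and the draws of SGD, $$\big|R_u(w^{(T+1)})-R_m(w^{(T+1)})\big|\le C\,L_{\mathcal F}\,\frac{(m+u)^{3/2}}{mu}\;\rho_\alpha(T)\;\log\frac2\delta,$$ where (a) $\rho_\alpha(T)=\log^{1/2}(T)\,T^{(1-2\alpha)/2}$ if $\alpha\in(0,\tfrac12)$; (b) $\rho_\alpha(T)=\log(T)$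 if $\alpha=\tfrac12$; (c) $\rho_\alpha(T)=\log^{1/2}(T)$ if $\alpha\in(\tfrac12,1]$. -/

import Mathlib

namespace TransductiveGNN

/-! ### Parameters -/

/-- Coordinates of `w = [vec W₁; …; vec W_H]`, where `W_h` is a `p h × q h` matrix. -/
abbrev ParamIdx {H : ℕ} (p q : Fin H → ℕ) : Type :=
  (h : Fin H) × (Fin (p h) × Fin (q h))

/-- The parameter space, with the Euclidean norm of the stacked vector. -/
abbrev Params {H : ℕ} (p q : Fin H → ℕ) : Type := EuclideanSpace ℝ (ParamIdx p q)

/-- The matrix `W_h` stored in the parameter vector `w`. -/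
def weightMatrix {H : ℕ} {p q : Fin H → ℕ} (w : Params p q) (h : Fin H) :
    Matrix (Fin (p h)) (Fin (q h)) ℝ :=
  Matrix.of fun a c => w ⟨h, (a, c)⟩

open scoped Matrix.Norms.L2Operator in
/-- The spectral norm of a real matrix. -/
noncomputable def spectralNorm {a c : ℕ} (A : Matrix (Fin a) (Fin c) ℝ) : ℝ := ‖A‖

/-! ### Graph neural networks -/

open Classical in
/-- The normalized adjacency matrix with self-loops
`(D + I)^{-1/2} (A + I) (D + I)^{-1/2}` of an undirected graph. -/
noncomputable def normAdj {n : ℕ} (Γ : SimpleGraph (Fin n)) : Matrix (Fin n) (Fin n) ℝ :=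
  Matrix.diagonal (fun i => (√((Γ.degree i : ℝ) + 1))⁻¹) * (Γ.adjMatrix ℝ + 1) *
    Matrix.diagonal (fun i => (√((Γ.degree i : ℝ) + 1))⁻¹)

/-- Architectures of graph neural networks with `d₀` input features and parameter matrices of shapes
`p h × q h`; an architecture of type `GNN d₀ p q k` assigns to every node a vector in `ℝᵏ`.
For instance, with `g = X` the two-layer GCN `Ã σ(Ã X W₁) W₂` is
`.weight 1 (.filter g (.act (.weight 0 (.filter g .input))))`; SGC and APPNP are of the same form,
GCNII also uses `.add` and `.smul`, and GPR-GNN uses `.learnedFilter`. -/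
inductive GNN (d₀ : ℕ) {H : ℕ} (p q : Fin H → ℕ) : ℕ → Type
  /-- the feature matrix `X` -/
  | input : GNN d₀ p q d₀
  /-- `Z ↦ Z W_h` -/
  | weight (h : Fin H) (Z : GNN d₀ p q (p h)) : GNN d₀ p q (q h)
  /-- `Z ↦ g(Ã) Z` for a fixed polynomial `g` -/
  | filter {k : ℕ} (g : Polynomial ℝ) (Z : GNN d₀ p q k) : GNN d₀ p q k
  /-- `Z ↦ ∑ᵢ γᵢ Ãⁱ Z`, where the coefficient vector `γ` is column `c` of `W_h` -/
  | learnedFilter {k : ℕ} (h : Fin H) (c : Fin (q h)) (Z : GNN d₀ p q k) : GNN d₀ p q k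
  /-- `Z ↦ σ(Z)`, entry by entry -/
  | act {k : ℕ} (Z : GNN d₀ p q k) : GNN d₀ p q k
  /-- `Z + Z'` -/
  | add {k : ℕ} (Z Z' : GNN d₀ p q k) : GNN d₀ p q k
  /-- `a Z` for a fixed real number `a` -/
  | smul {k : ℕ} (a : ℝ) (Z : GNN d₀ p q k) : GNN d₀ p q k

/-- The output of an architecture: row `i` is the output at node `i`. -/
noncomputable def GNN.eval {n d₀ H : ℕ} {p q : Fin H → ℕ} (act : ℝ → ℝ)
    (A : Matrix (Fin n) (Fin n) ℝ) (X : Matrix (Fin n) (Fin d₀) ℝ) (w : Params p q) :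
    {k : ℕ} → GNN d₀ p q k → Matrix (Fin n) (Fin k) ℝ
  | _, .input => X
  | _, .weight h Z => GNN.eval act A X w Z * weightMatrix w h
  | _, .filter g Z => Polynomial.aeval A g * GNN.eval act A X w Z
  | _, .learnedFilter h c Z =>
      (∑ i : Fin (p h), weightMatrix w h i c • A ^ (i : ℕ)) * GNN.eval act A X w Z
  | _, .act Z => (GNN.eval act A X w Z).map act
  | _, .add Z Z' => GNN.eval act A X w Z + GNN.eval act A X w Z'
  | _, .smul a Z => a • GNN.eval act A X w Z

/-! ### Losses -/

/-- A nonnegative loss of a label and an output vector in `ℝᵏ` which is twice continuously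
differentiable in the output vector. -/
structure PredictionLoss (𝒴 : Type*) (k : ℕ) where
  toFun : 𝒴 → (Fin k → ℝ) → ℝ
  nonneg : ∀ y v, 0 ≤ toFun y v
  contDiff : ∀ y, ContDiff ℝ 2 (toFun y)

/-- Softmax followed by the cross-entropy with a one-hot label is such a loss. -/
noncomputable def crossEntropy (k : ℕ) : PredictionLoss (Fin k) k where
  toFun y v := - Real.log (Real.exp (v y) / ∑ j, Real.exp (v j))
  nonneg y v := by
    have h : Real.exp (v y) ≤ ∑ j, Real.exp (v j) :=
      Finset.single_le_sum (f := fun j => Real.exp (v j)) (fun j _ => (Real.exp_pos _).le)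
        (Finset.mem_univ y)
    have h0 : 0 < ∑ j, Real.exp (v j) := lt_of_lt_of_le (Real.exp_pos _) h
    exact neg_nonneg.mpr (Real.log_nonpos (by positivity) ((div_le_one h0).mpr h))
  contDiff y := by
    have h0 : ∀ v : Fin k → ℝ, (∑ j, Real.exp (v j)) ≠ 0 := fun v =>
      (Finset.sum_pos (fun j _ => Real.exp_pos _) ⟨y, Finset.mem_univ y⟩).ne'
    have h1 : ContDiff ℝ 2 fun v : Fin k → ℝ => ∑ j, Real.exp (v j) := by fun_prop
    have h2 : ContDiff ℝ 2 fun v : Fin k → ℝ => Real.exp (v y) := by fun_prop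
    exact ((h2.div h1 h0).log fun v => div_ne_zero (Real.exp_pos _).ne' (h0 v)).neg

/-- The objective `ℓ(w; zᵢ)`: the loss, at the label of node `i`, of the output at node `i`. -/
noncomputable def nodeLoss {n d₀ k H : ℕ} {p q : Fin H → ℕ} {𝒴 : Type*}
    (net : GNN d₀ p q k) (act : ℝ → ℝ) (φ : PredictionLoss 𝒴 k) (Γ : SimpleGraph (Fin n))
    (X : Matrix (Fin n) (Fin d₀) ℝ) (y : Fin n → 𝒴) (i : Fin n) (w : Params p q) : ℝ :=
  φ.toFun (y i) (net.eval act (normAdj Γ) X w i)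

section Objective

variable {E : Type*} [NormedAddCommGroup E] [InnerProductSpace ℝ E] [CompleteSpace E]

/-- The smallest `L ≥ 0` such that every `ℓ(·; zᵢ)` is `L`-Lipschitz on the ball `B(w₁; r)`. -/
noncomputable def lipschitzConst {n : ℕ} (ℓ : Fin n → E → ℝ) (w₁ : E) (r : ℝ) : ℝ :=
  sInf {L : ℝ | 0 ≤ L ∧ ∀ i, ∀ w ∈ Metric.closedBall w₁ r, ∀ w' ∈ Metric.closedBall w₁ r,
    |ℓ i w - ℓ i w'| ≤ L * ‖w - w'‖}

/-- The smallest `P ≥ 0` such that `‖∇ℓ(w; zᵢ) - ∇ℓ(w'; zᵢ)‖ ≤ P max {‖w - w'‖^α, ‖w - w'‖}`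
for all `i` and all `w`, `w'` in the ball `B(w₁; r)`. -/
noncomputable def holderConst {n : ℕ} (ℓ : Fin n → E → ℝ) (α : ℝ) (w₁ : E) (r : ℝ) : ℝ :=
  sInf {P : ℝ | 0 ≤ P ∧ ∀ i, ∀ w ∈ Metric.closedBall w₁ r, ∀ w' ∈ Metric.closedBall w₁ r,
    ‖gradient (ℓ i) w - gradient (ℓ i) w'‖ ≤ P * max (‖w - w'‖ ^ α) ‖w - w'‖}

/-! ### Transductive learning and SGD -/

/-- Outcomes: a permutation `π` of the `m + u` nodes, whose first `m` values are the training nodes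
and whose last `u` values are the test nodes, and the `T` training indices drawn by SGD. -/
structure Outcome (m u T : ℕ) where
  split : Equiv.Perm (Fin (m + u))
  draw : Fin T → Fin m

/-- An outcome amounts to a pair of a permutation and a sequence of draws. -/
def Outcome.equiv (m u T : ℕ) :
    Outcome m u T ≃ Equiv.Perm (Fin (m + u)) × (Fin T → Fin m) where
  toFun ω := (ω.split, ω.draw)
  invFun x := ⟨x.1, x.2⟩
  left_inv _ := rfl
  right_inv _ := rfl

instance (m u T : ℕ) : Fintype (Outcome m u T) := Fintype.ofEquiv _ (Outcome.equiv m u T).symm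

instance (m u T : ℕ) [NeZero m] : Nonempty (Outcome m u T) := ⟨⟨Equiv.refl _, fun _ => 0⟩⟩

instance (m u T : ℕ) : MeasurableSpace (Outcome m u T) := ⊤

/-- The probability of an event when all outcomes are equally likely: the partition into training
and test nodes is uniform, and the draws of SGD are independent of it, mutually independent and
uniform on the training indices. -/
noncomputable def prob {m u T : ℕ} [NeZero m] (s : Set (Outcome m u T)) : ℝ :=
  (PMF.uniformOfFintype (Outcome m u T)).toMeasure.real s

/-- The training error `R_m`. -/
noncomputable def trainErr {m u : ℕ} (ℓ : Fin (m + u) → E → ℝ) (π : Equiv.Perm (Fin (m + u)))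
    (w : E) : ℝ :=
  (1 / (m : ℝ)) * ∑ i : Fin m, ℓ (π (Fin.castAdd u i)) w

/-- The test error `R_u`. -/
noncomputable def testErr {m u : ℕ} (ℓ : Fin (m + u) → E → ℝ) (π : Equiv.Perm (Fin (m + u)))
    (w : E) : ℝ :=
  (1 / (u : ℝ)) * ∑ i : Fin u, ℓ (π (Fin.natAdd m i)) w

/-- The learning rate `η_t = 1 / (t + t₀)`. -/
noncomputable def learningRate (t₀ : ℝ) (t : ℕ) : ℝ := 1 / ((t : ℝ) + t₀)

/-- The iterates of SGD, counted from zero: `sgd ℓ w₁ t₀ ω t` is `w^{(t+1)}`, so that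
`w^{(1)} = w₁` and `w^{(t+2)} = w^{(t+1)} - η_{t+1} ∇ℓ(w^{(t+1)}; z_{j_{t+1}})` for `t < T`. -/
noncomputable def sgd {m u T : ℕ} (ℓ : Fin (m + u) → E → ℝ) (w₁ : E) (t₀ : ℝ)
    (ω : Outcome m u T) : ℕ → E
  | 0 => w₁
  | t + 1 =>
    if h : t < T then
      sgd ℓ w₁ t₀ ω t - learningRate t₀ (t + 1) •
        gradient (ℓ (ω.split (Fin.castAdd u (ω.draw ⟨t, h⟩)))) (sgd ℓ w₁ t₀ ω t)
    else sgd ℓ w₁ t₀ ω t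

/-- The transductive generalization gap `|R_u(w^{(T+1)}) - R_m(w^{(T+1)})|` of the last iterate. -/
noncomputable def genGap {m u T : ℕ} (ℓ : Fin (m + u) → E → ℝ) (w₁ : E) (t₀ : ℝ)
    (ω : Outcome m u T) : ℝ :=
  |testErr ℓ ω.split (sgd ℓ w₁ t₀ ω T) - trainErr ℓ ω.split (sgd ℓ w₁ t₀ ω T)|

/-- All iterates `w^{(1)}, …, w^{(T+1)}` stay in the ball `B(w₁; r)`. -/
def IteratesInBall {m u : ℕ} (T : ℕ) (ℓ : Fin (m + u) → E → ℝ) (w₁ : E) (t₀ r : ℝ) : Prop :=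
  ∀ ω : Outcome m u T, ∀ t ≤ T, sgd ℓ w₁ t₀ ω t ∈ Metric.closedBall w₁ r

/-- `√η_t ‖∇ℓ(w^{(t)}; z)‖ ≤ G` for all nodes `z` and all `t = 1, …, T`. -/
def BoundedScaledGradients {m u : ℕ} (T : ℕ) (ℓ : Fin (m + u) → E → ℝ) (w₁ : E) (t₀ G : ℝ) :
    Prop :=
  ∀ ω : Outcome m u T, ∀ t < T, ∀ i,
    √(learningRate t₀ (t + 1)) * ‖gradient (ℓ i) (sgd ℓ w₁ t₀ ω t)‖ ≤ G

/-- `E_j ‖∇ℓ(w^{(t)}; z_j) - ∇R_m(w^{(t)})‖² ≤ σ₀²` for all `t = 1, …, T`, where `j` is uniform on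
the training indices. -/
def BoundedGradientVariance {m u : ℕ} (T : ℕ) (ℓ : Fin (m + u) → E → ℝ) (w₁ : E) (t₀ σ₀ : ℝ) :
    Prop :=
  ∀ ω : Outcome m u T, ∀ t < T,
    (1 / (m : ℝ)) * ∑ j : Fin m,
      ‖gradient (ℓ (ω.split (Fin.castAdd u j))) (sgd ℓ w₁ t₀ ω t) -
        gradient (trainErr ℓ ω.split) (sgd ℓ w₁ t₀ ω t)‖ ^ 2 ≤ σ₀ ^ 2

end Objective

end TransductiveGNN

/-!
# Generalization of transductive graph neural networks trained by SGD

The proof bounds how far SGD travels, and then bounds the generalization gap uniformly over a ball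
of that radius. It gives the rate `√(log T) · log (2 / δ)` for every `α ∈ (0, 1]`, which for
`T ≥ 2` is, up to a constant factor, at most each of the three rates of the theorem.

*Distance travelled.* `w^{(T+1)} - w^{(1)}` is minus the sum of the drift `∑ η_t ∇R_m(w^{(t)})` and
of the noise `∑ η_t ξ_t`, where `ξ_t` is the stochastic gradient minus its mean. Each coordinate of
the noise is a martingale with increments at most `2 G √η_t`; since `∑ η_t ≤ 2 log T`, Hoeffding's
inequality bounds it by a multiple of `√(log T · log (2 / δ))` (`prob_exists_noise_gt_le`). For the
drift, Hölder continuity of the gradient gives the descent inequality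
`R_m(w^{(t+1)}) ≤ R_m(w^{(t)}) - η_t ⟨∇R_m, g_t⟩ + P_F η_t^{1+α} (1 + ‖g_t‖²)`. As `∑ η_t^{1+α}`
converges and `η_t ‖g_t‖²` is bounded, a suitable exponential of
`R_m(w^{(t)}) + ½ ∑_{s<t} η_s ‖∇R_m(w^{(s)})‖²`, divided by a deterministic factor that stays
bounded, is a supermartingale (`sum_exp_energy_le`). Because `R_m ≥ 0`, this yields
`∑ η_t ‖∇R_m(w^{(t)})‖² ≤ const · log (2 / δ)`, and by the Cauchy–Schwarz inequality the drift is
at most a multiple of `√(log T · log (2 / δ))` as well (`prob_norm_sgd_sub_gt_le`).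

*Uniform deviations.* For fixed node weights bounded by `B`, test average minus training average is
sub-Gaussian with parameter a multiple of `B (m + u)^{3/2} / (m u)`: draw the training nodes one
after the other and use Hoeffding's lemma at each draw (`sum_perm_exp_le`). Chaining along dyadic
nets of the ball of radius `R` in dimension at most `D` makes this uniform, at the cost of a factor
that depends on `D` only (`prob_exists_gap_gt_le`). The gap at `w^{(1)}` itself is controlled by the
bound `b` on the loss there, and `b ≤ (b / L₀) L`.

*Smoothness of the network.* The Hölder and Lipschitz constants are infima over sets of admissible
constants, so they bound anything only if those sets are nonempty. For the Hölder constant this is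
shown by induction over the architecture: each entry of the output is differentiable, with a
derivative that is bounded and `α`-Hölder on the ball (`GNN.isHolderC1_eval`). For the Lipschitz
constant it follows from its positivity, since the infimum of the empty set is `0`.

Probabilities and expectations are finite averages over outcomes. Conditioning on the first `t`
draws is replaced by averaging over a new value of draw `t` (`Outcome.redraw`, `sum_redraw`).
-/

namespace TransductiveGNN

/-! ### Exponential moments and tails of finite averages -/

/-- On `[-c, c]` the exponential lies below its chord. -/
theorem exp_le_chord {x c : ℝ} (hc : 0 < c) (hx : |x| ≤ c) :
    Real.exp x ≤ Real.cosh c + x * (Real.sinh c / c) := by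
  obtain ⟨h1, h2⟩ := abs_le.mp hx
  have hconv := (convexOn_exp.2 (Set.mem_univ (-c)) (Set.mem_univ c))
    (a := (c - x) / (2 * c)) (b := (c + x) / (2 * c))
    (div_nonneg (by linarith) (by linarith)) (div_nonneg (by linarith) (by linarith))
    (by field_simp; ring)
  simp only [smul_eq_mul] at hconv
  have he : (c - x) / (2 * c) * -c + (c + x) / (2 * c) * c = x := by field_simp; ring
  rw [he] at hconv
  refine hconv.trans (le_of_eq ?_)
  rw [Real.cosh_eq, Real.sinh_eq]
  field_simp
  ring

/-- Hoeffding's lemma for a uniform average. -/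
theorem sum_exp_le_of_sum_eq_zero {ι : Type*} [Fintype ι] (x : ι → ℝ) {c : ℝ}
    (hx : ∀ i, |x i| ≤ c) (h0 : ∑ i, x i = 0) :
    ∑ i, Real.exp (x i) ≤ Fintype.card ι * Real.exp (c ^ 2 / 2) := by
  rcases lt_or_ge 0 c with hc | hc
  · calc ∑ i, Real.exp (x i) ≤ ∑ i, (Real.cosh c + x i * (Real.sinh c / c)) :=
          Finset.sum_le_sum fun i _ => exp_le_chord hc (hx i)
      _ = Fintype.card ι * Real.cosh c := by
          rw [Finset.sum_add_distrib, ← Finset.sum_mul, h0]; simp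
      _ ≤ _ := by gcongr; exact Real.cosh_le_exp_half_sq c
  · have hx0 : ∀ i, x i = 0 := fun i => by
      have := abs_nonneg (x i)
      exact abs_eq_zero.mp (le_antisymm ((hx i).trans hc) this)
    simp only [hx0, Real.exp_zero, Finset.sum_const, Finset.card_univ, nsmul_eq_mul]
    gcongr
    exact Real.one_le_exp (by positivity)

section Probability

variable {m u T : ℕ}

theorem sum_outcome (F : Outcome m u T → ℝ) :
    ∑ ω, F ω = ∑ π, ∑ j, F ⟨π, j⟩ := by
  rw [← Fintype.sum_prod_type']
  exact Fintype.sum_equiv (Outcome.equiv m u T) _ _ fun ω => rfl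

theorem card_outcome : Fintype.card (Outcome m u T) =
    Fintype.card (Equiv.Perm (Fin (m + u))) * Fintype.card (Fin T → Fin m) := by
  rw [Fintype.card_congr (Outcome.equiv m u T), Fintype.card_prod]

variable [NeZero m]

theorem prob_eq_sum (s : Set (Outcome m u T)) :
    prob s = (∑ ω, s.indicator 1 ω) / Fintype.card (Outcome m u T) := by
  classical
  unfold prob
  rw [MeasureTheory.measureReal_def,
    PMF.toMeasure_uniformOfFintype_apply _ (MeasurableSet.of_discrete), ENNReal.toReal_div]
  simp only [ENNReal.toReal_natCast]
  congr 1
  simp [Set.indicator_apply, Finset.sum_boole, Fintype.card_subtype]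

theorem prob_mono {s t : Set (Outcome m u T)} (h : s ⊆ t) : prob s ≤ prob t :=
  MeasureTheory.measureReal_mono h

theorem prob_union_le (s t : Set (Outcome m u T)) : prob (s ∪ t) ≤ prob s + prob t :=
  MeasureTheory.measureReal_union_le s t

theorem prob_biUnion_le {ι : Type*} (I : Finset ι) (s : ι → Set (Outcome m u T)) :
    prob (⋃ i ∈ I, s i) ≤ ∑ i ∈ I, prob (s i) :=
  MeasureTheory.measureReal_biUnion_finset_le I s

theorem prob_compl (s : Set (Outcome m u T)) : prob sᶜ = 1 - prob s :=
  MeasureTheory.probReal_compl_eq_one_sub MeasurableSet.of_discrete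

/-- Markov's inequality: if `F ≥ 0` is at least `1` on `s` and has mean at most `ε`, then `s` has
probability at most `ε`. -/
theorem prob_le_of_sum_le {s : Set (Outcome m u T)} (F : Outcome m u T → ℝ) {ε : ℝ}
    (h0 : ∀ ω, 0 ≤ F ω) (h1 : ∀ ω ∈ s, 1 ≤ F ω)
    (hF : ∑ ω, F ω ≤ Fintype.card (Outcome m u T) * ε) : prob s ≤ ε := by
  have hc : (0 : ℝ) < Fintype.card (Outcome m u T) := by exact_mod_cast Fintype.card_pos
  rw [prob_eq_sum, div_le_iff₀ hc, mul_comm]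
  refine le_trans (Finset.sum_le_sum fun ω _ => ?_) hF
  by_cases hω : ω ∈ s
  · simpa [hω] using h1 ω hω
  · simpa [hω] using h0 ω

/-- The sub-Gaussian tail bound, from a bound on the moment generating function. -/
theorem prob_abs_gt_le (X : Outcome m u T → ℝ) {σ x : ℝ} (hσ : 0 < σ)
    (hX : ∀ θ : ℝ, ∑ ω, Real.exp (θ * X ω) ≤
      Fintype.card (Outcome m u T) * Real.exp (2 * θ ^ 2 * σ ^ 2)) (hx : 0 ≤ x) :
    prob {ω | σ * x < |X ω|} ≤ 2 * Real.exp (-(x ^ 2 / 8)) := by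
  -- this `θ` minimizes `2 θ² σ² - θ σ x`
  set θ := x / (4 * σ) with hθ
  have hθ0 : 0 ≤ θ := by positivity
  have hθσ : θ * σ = x / 4 := by rw [hθ]; field_simp
  refine prob_le_of_sum_le
    (fun ω => (Real.exp (θ * X ω) + Real.exp (-θ * X ω)) * Real.exp (-(x ^ 2 / 4)))
    (fun ω => by positivity) (fun ω hω => ?_) ?_
  · have hω' : σ * x < |X ω| := hω
    have hbd : x ^ 2 / 4 ≤ θ * |X ω| :=
      calc x ^ 2 / 4 = θ * (σ * x) := by rw [← mul_assoc, hθσ]; ring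
        _ ≤ _ := by gcongr
    have h1 : Real.exp (x ^ 2 / 4) ≤ Real.exp (θ * X ω) + Real.exp (-θ * X ω) := by
      rcases abs_cases (X ω) with ⟨h, _⟩ | ⟨h, _⟩
      · rw [h] at hbd
        have := Real.exp_le_exp.mpr hbd
        have := Real.exp_pos (-θ * X ω)
        linarith
      · rw [h] at hbd
        have := Real.exp_le_exp.mpr (hbd.trans_eq (by ring : θ * -X ω = -θ * X ω))
        have := Real.exp_pos (θ * X ω)
        linarith
    calc (1 : ℝ) = Real.exp (x ^ 2 / 4) * Real.exp (-(x ^ 2 / 4)) := by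
          rw [← Real.exp_add]; simp
      _ ≤ _ := by gcongr
  · rw [← Finset.sum_mul, Finset.sum_add_distrib]
    have h1 := hX θ
    have h2 := hX (-θ)
    have he : Real.exp (2 * θ ^ 2 * σ ^ 2) * Real.exp (-(x ^ 2 / 4)) = Real.exp (-(x ^ 2 / 8)) := by
      rw [← Real.exp_add]
      congr 1
      have : 2 * θ ^ 2 * σ ^ 2 = 2 * (θ * σ) ^ 2 := by ring
      rw [this, hθσ]; ring
    rw [neg_sq] at h2
    calc _ ≤ (Fintype.card (Outcome m u T) * Real.exp (2 * θ ^ 2 * σ ^ 2) +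
          Fintype.card (Outcome m u T) * Real.exp (2 * θ ^ 2 * σ ^ 2)) * Real.exp (-(x ^ 2 / 4)) := by
          gcongr
      _ = _ := by rw [← he]; ring

end Probability

/-! ### Sampling without replacement -/

/-- The sum of `a` over the first `k` values of a uniform permutation of `Fin n` is sub-Gaussian about
its mean. The induction conditions on the first value `p`: given `p`, the remaining values form a
uniform permutation of the other points, and the conditional mean of the whole sum varies with `p`
as `(1 - k / n) a p`, to which Hoeffding's lemma applies. -/
theorem sum_perm_exp_le (n : ℕ) : ∀ (k : ℕ) (a : Fin n → ℝ) {B : ℝ} (θ : ℝ), k ≤ n →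
    (∀ i, |a i| ≤ B) →
    ∑ σ : Equiv.Perm (Fin n), Real.exp (θ * ((∑ i : Fin n, if i.val < k then a (σ i) else 0) -
      k / n * ∑ i, a i)) ≤
      Fintype.card (Equiv.Perm (Fin n)) * Real.exp (k * (2 * (θ * B) ^ 2)) := by
  induction n with
  | zero =>
    intro k a B θ hk _
    obtain rfl : k = 0 := by omega
    simp
  | succ n ih =>
    intro k a B θ hk ha
    rcases k with _ | k
    · simp
    have hB : 0 ≤ B := (abs_nonneg _).trans (ha 0)
    set S := ∑ i, a i with hS
    let a' : Fin (n + 1) → Fin n → ℝ := fun p j => a (Equiv.swap 0 p j.succ)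
    have ha' : ∀ p, ∑ j, a' p j = S - a p := fun p => by
      have h := Equiv.sum_comp (Equiv.swap 0 p) a
      rw [Fin.sum_univ_succ, Equiv.swap_apply_left] at h
      simp only [a', hS]
      linarith
    have hkn : (k : ℝ) / n ≤ 1 := by
      apply div_le_one_of_le₀ _ (Nat.cast_nonneg n)
      exact_mod_cast Nat.le_of_succ_le_succ hk
    have hkn0 : (0 : ℝ) ≤ k / n := by positivity
    have hn1 : (0 : ℝ) < (n : ℝ) + 1 := by positivity
    -- for `n = 0` both sides vanish, with `k / n = 0`
    have hid : ∀ p, a p + k / n * (S - a p) - ((k + 1 : ℕ) : ℝ) / ((n + 1 : ℕ) : ℝ) * S =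
        (1 - k / n) * (a p - S / (n + 1)) := fun p => by
      rcases Nat.eq_zero_or_pos n with hn | hn
      · subst hn
        obtain rfl : k = 0 := by omega
        simp
      · have : (0 : ℝ) < n := by exact_mod_cast hn
        push_cast
        field_simp
        ring
    let x : Fin (n + 1) → ℝ := fun p => θ * ((1 - k / n) * (a p - S / (n + 1)))
    have hx0 : ∑ p, x p = 0 := by
      simp only [x]
      rw [← Finset.mul_sum, ← Finset.mul_sum, Finset.sum_sub_distrib]
      simp only [Finset.sum_const, Finset.card_univ, Fintype.card_fin, nsmul_eq_mul, ← hS]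
      push_cast
      field_simp
      ring
    have hSB : |S / (n + 1)| ≤ B := by
      rw [abs_div, abs_of_pos hn1, div_le_iff₀ hn1]
      calc |S| ≤ ∑ i, |a i| := Finset.abs_sum_le_sum_abs _ _
        _ ≤ ∑ _i : Fin (n + 1), B := Finset.sum_le_sum fun i _ => ha i
        _ = _ := by simp; ring
    have hxB : ∀ p, |x p| ≤ 2 * (|θ| * B) := fun p => by
      have h1 : |a p - S / (n + 1)| ≤ B + B := (abs_sub _ _).trans (add_le_add (ha p) hSB)
      have h2 : |1 - (k : ℝ) / n| ≤ 1 := abs_le.mpr ⟨by linarith, by linarith⟩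
      simp only [x, abs_mul]
      calc |θ| * (|1 - (k : ℝ) / n| * |a p - S / (n + 1)|) ≤ |θ| * (1 * (B + B)) := by gcongr
        _ = _ := by ring
    have hcard : (Fintype.card (Equiv.Perm (Fin (n + 1))) : ℝ) =
        Fintype.card (Fin (n + 1)) * Fintype.card (Equiv.Perm (Fin n)) := by
      rw [← Nat.cast_mul, ← Fintype.card_prod, Fintype.card_congr Equiv.Perm.decomposeFin]
    rw [← Equiv.sum_comp Equiv.Perm.decomposeFin.symm, Fintype.sum_prod_type, hcard]
    calc _ = ∑ p : Fin (n + 1), Real.exp (x p) * ∑ e : Equiv.Perm (Fin n),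
          Real.exp (θ * ((∑ i : Fin n, if i.val < k then a' p (e i) else 0) -
            k / n * ∑ i, a' p i)) := by
          refine Finset.sum_congr rfl fun p _ => ?_
          simp only [Finset.mul_sum (Finset.univ : Finset (Equiv.Perm (Fin n)))]
          refine Finset.sum_congr rfl fun e _ => ?_
          rw [← Real.exp_add]
          congr 1
          rw [ha', Fin.sum_univ_succ]
          simp only [Equiv.Perm.decomposeFin_symm_apply_zero,
            Equiv.Perm.decomposeFin_symm_apply_succ, Fin.val_zero, Fin.val_succ,
            Nat.add_lt_add_iff_right, Nat.zero_lt_succ, if_true, x, ← hid, a']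
          ring
      _ ≤ ∑ p, Real.exp (x p) * (Fintype.card (Equiv.Perm (Fin n)) *
            Real.exp (k * (2 * (θ * B) ^ 2))) := by
          gcongr with p
          exact ih k (a' p) θ (Nat.le_of_succ_le_succ hk) fun i => ha _
      _ ≤ (Fintype.card (Fin (n + 1)) * Real.exp ((2 * (|θ| * B)) ^ 2 / 2)) *
            (Fintype.card (Equiv.Perm (Fin n)) * Real.exp (k * (2 * (θ * B) ^ 2))) := by
          rw [← Finset.sum_mul]
          gcongr
          exact sum_exp_le_of_sum_eq_zero x hxB hx0
      _ = _ := by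
          have : Real.exp (((k + 1 : ℕ) : ℝ) * (2 * (θ * B) ^ 2)) =
              Real.exp ((2 * (|θ| * B)) ^ 2 / 2) * Real.exp (k * (2 * (θ * B) ^ 2)) := by
            rw [← Real.exp_add]
            congr 1
            rw [mul_pow, mul_pow, mul_pow |θ|, sq_abs]
            push_cast
            ring
          rw [this]
          ring

/-- Test average minus training average of node weights `a`. -/
noncomputable def splitGap {m u : ℕ} (a : Fin (m + u) → ℝ) (π : Equiv.Perm (Fin (m + u))) : ℝ :=
  (1 / (u : ℝ)) * ∑ i : Fin u, a (π (Fin.natAdd m i)) -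
    (1 / (m : ℝ)) * ∑ i : Fin m, a (π (Fin.castAdd u i))

/-- The sample size factor `(m + u)^{3/2} / (m u)`. -/
noncomputable def sizeFactor (m u : ℕ) : ℝ := ((m : ℝ) + u) ^ (3 / 2 : ℝ) / ((m : ℝ) * u)

section
variable {m u : ℕ} [NeZero m] [NeZero u]

theorem sizeFactor_pos : 0 < sizeFactor m u := by
  have hm : (0 : ℝ) < m := by exact_mod_cast NeZero.pos m
  have hu : (0 : ℝ) < u := by exact_mod_cast NeZero.pos u
  unfold sizeFactor
  positivity

theorem sizeFactor_sq : sizeFactor m u ^ 2 = ((m : ℝ) + u) ^ 3 / ((m : ℝ) * u) ^ 2 := by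
  have hm : (0 : ℝ) < m := by exact_mod_cast NeZero.pos m
  have hu : (0 : ℝ) < u := by exact_mod_cast NeZero.pos u
  unfold sizeFactor
  rw [div_pow, ← Real.rpow_natCast (((m : ℝ) + u) ^ (3 / 2 : ℝ)), ← Real.rpow_mul (by positivity)]
  norm_num

theorem splitGap_eq (a : Fin (m + u) → ℝ) (π : Equiv.Perm (Fin (m + u))) :
    splitGap a π = -(((m : ℝ) + u) / (m * u)) *
      ((∑ i : Fin (m + u), if i.val < m then a (π i) else 0) -
        m / ((m + u : ℕ) : ℝ) * ∑ i, a i) := by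
  have hm : (0 : ℝ) < m := by exact_mod_cast NeZero.pos m
  have hu : (0 : ℝ) < u := by exact_mod_cast NeZero.pos u
  rw [← Equiv.sum_comp π a, Fin.sum_univ_add, Fin.sum_univ_add]
  simp only [Fin.val_castAdd, Fin.is_lt, if_true, Fin.val_natAdd, Nat.not_lt.mpr (Nat.le_add_right m _),
    if_false, Finset.sum_const_zero, add_zero]
  unfold splitGap
  push_cast
  field_simp
  ring

theorem sum_exp_splitGap_le (a : Fin (m + u) → ℝ) {B : ℝ} (ha : ∀ i, |a i| ≤ B) (θ : ℝ) :
    ∑ π, Real.exp (θ * splitGap a π) ≤ Fintype.card (Equiv.Perm (Fin (m + u))) *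
      Real.exp (2 * θ ^ 2 * (B * sizeFactor m u) ^ 2) := by
  have hm : (0 : ℝ) < m := by exact_mod_cast NeZero.pos m
  have hu : (0 : ℝ) < u := by exact_mod_cast NeZero.pos u
  have h := sum_perm_exp_le (m + u) m a (-(θ * (((m : ℝ) + u) / (m * u)))) (Nat.le_add_right m u) ha
  calc _ = _ := Finset.sum_congr rfl fun π _ => by
          rw [splitGap_eq, ← mul_assoc, mul_neg]
    _ ≤ _ := h
    _ ≤ _ := by
          refine mul_le_mul_of_nonneg_left (Real.exp_le_exp.mpr ?_) (Nat.cast_nonneg _)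
          rw [mul_pow B, sizeFactor_sq]
          have h1 : (m : ℝ) * (2 * (-(θ * (((m : ℝ) + u) / (m * u))) * B) ^ 2) =
              2 * θ ^ 2 * (B ^ 2 * (((m : ℝ) + u) ^ 2 * m / ((m : ℝ) * u) ^ 2)) := by
            field_simp
          rw [h1]
          gcongr
          calc ((m : ℝ) + u) ^ 2 * m ≤ ((m : ℝ) + u) ^ 2 * (m + u) := by gcongr; linarith
            _ = _ := by ring

theorem prob_splitGap_gt_le {T : ℕ} (a : Fin (m + u) → ℝ) {B x : ℝ} (ha : ∀ i, |a i| ≤ B)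
    (hB : 0 ≤ B) (hx : 0 ≤ x) :
    prob {ω : Outcome m u T | B * sizeFactor m u * x < |splitGap a ω.split|} ≤
      2 * Real.exp (-(x ^ 2 / 8)) := by
  rcases hB.eq_or_lt with rfl | hB
  · have : {ω : Outcome m u T | 0 * sizeFactor m u * x < |splitGap a ω.split|} = ∅ := by
      ext ω
      have ha0 : ∀ i, a i = 0 := fun i => abs_nonpos_iff.mp (ha i)
      simp [splitGap, ha0]
    rw [this]
    simp only [prob, MeasureTheory.measureReal_empty]
    positivity
  · refine prob_abs_gt_le (fun ω => splitGap a ω.split) (mul_pos hB sizeFactor_pos) (fun θ => ?_) hx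
    rw [sum_outcome, card_outcome]
    simp only [Finset.sum_const, Finset.card_univ, nsmul_eq_mul, ← Finset.mul_sum]
    have := sum_exp_splitGap_le a ha θ
    calc _ ≤ (Fintype.card (Fin T → Fin m) : ℝ) * (Fintype.card (Equiv.Perm (Fin (m + u))) *
          Real.exp (2 * θ ^ 2 * (B * sizeFactor m u) ^ 2)) := by gcongr
      _ = _ := by push_cast; ring

end

/-! ### Chaining over a Euclidean ball -/

/-- If `f` maps `S` into a finite set `A`, then one point of `S` from each nonempty fibre gives a finite
subset of `S`, of size at most that of `A`, which meets every fibre that `S` meets. -/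
theorem exists_finset_representatives {E β : Type*} [DecidableEq E] (f : E → β) (S : Set E)
    (A : Finset β) (hf : ∀ w ∈ S, f w ∈ A) :
    ∃ N : Finset E, (∀ v ∈ N, v ∈ S) ∧ N.card ≤ A.card ∧ ∀ w ∈ S, ∃ v ∈ N, f v = f w := by
  classical
  rcases S.eq_empty_or_nonempty with rfl | ⟨w₀, hw₀⟩
  · exact ⟨∅, by simp, by simp, by simp⟩
  let g : β → E := fun x => if h : ∃ w ∈ S, f w = x then h.choose else w₀
  have hgS : ∀ x, g x ∈ S := fun x => by
    by_cases h : ∃ w ∈ S, f w = x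
    · simp only [g, dif_pos h]; exact h.choose_spec.1
    · simpa only [g, dif_neg h] using hw₀
  refine ⟨A.image g, fun v hv => ?_, Finset.card_image_le, fun w hw =>
    ⟨g (f w), Finset.mem_image_of_mem _ (hf w hw), ?_⟩⟩
  · obtain ⟨x, _, rfl⟩ := Finset.mem_image.mp hv
    exact hgS x
  · have h : ∃ w' ∈ S, f w' = f w := ⟨w, hw, rfl⟩
    simp only [g, dif_pos h]
    exact h.choose_spec.2

section
variable {ι : Type*} [Fintype ι] {D : ℕ}

theorem norm_le_of_forall_coord_le (hD : Fintype.card ι ≤ D) (x : EuclideanSpace ℝ ι) {M : ℝ}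
    (hM : 0 ≤ M) (hx : ∀ c, |x c| ≤ M) : ‖x‖ ≤ (D + 1) * M := by
  have hD' : (Fintype.card ι : ℝ) ≤ D := by exact_mod_cast hD
  refine le_of_sq_le_sq ?_ (by positivity)
  rw [EuclideanSpace.norm_sq_eq]
  calc ∑ c, ‖x c‖ ^ 2 ≤ ∑ _c : ι, M ^ 2 := by
        gcongr with c
        exact hx c
    _ = Fintype.card ι * M ^ 2 := by simp
    _ ≤ D * M ^ 2 := by gcongr
    _ ≤ (D + 1) ^ 2 * M ^ 2 := by
        gcongr
        nlinarith [(Nat.cast_nonneg D : (0 : ℝ) ≤ D)]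
    _ = _ := by ring

/-- A dyadic net of a subset of a ball, with points in the subset itself: one representative for each
grid cell of mesh `R 2⁻ᵏ` that the subset meets. -/
theorem exists_net (hD : Fintype.card ι ≤ D) (S : Set (EuclideanSpace ℝ ι))
    (w₁ : EuclideanSpace ℝ ι) {R : ℝ} (hR : 0 < R) (hS : ∀ w ∈ S, ‖w - w₁‖ ≤ R) (k : ℕ) :
    ∃ N : Finset (EuclideanSpace ℝ ι), (∀ v ∈ N, v ∈ S) ∧ N.card ≤ 2 ^ ((k + 2) * D) ∧
      ∀ w ∈ S, ∃ v ∈ N, ‖w - v‖ ≤ (D + 1) * R * (1 / 2) ^ k := by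
  classical
  let f : EuclideanSpace ℝ ι → ι → ℤ := fun w c => ⌊2 ^ k * ((w c - w₁ c) / R)⌋
  let A : Finset (ι → ℤ) := Fintype.piFinset fun _ => Finset.Icc (-2 ^ k) (2 ^ k)
  obtain ⟨N, hNS, hNc, hN⟩ := exists_finset_representatives f S A fun w hw => by
    refine Fintype.mem_piFinset.mpr fun c => Finset.mem_Icc.mpr ?_
    have h1 : |w c - w₁ c| ≤ R := (PiLp.norm_apply_le (w - w₁) c).trans (hS w hw)
    have h2 : |(w c - w₁ c) / R| ≤ 1 := by
      rw [abs_div, abs_of_pos hR]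
      exact div_le_one_of_le₀ h1 hR.le
    obtain ⟨h3, h4⟩ := abs_le.mp h2
    have hk : (0 : ℝ) < 2 ^ k := by positivity
    constructor
    · refine Int.le_floor.mpr ?_
      push_cast
      nlinarith
    · refine Int.floor_le_iff.mpr ?_
      push_cast
      nlinarith
  refine ⟨N, hNS, hNc.trans ?_, fun w hw => ?_⟩
  · simp only [A, Fintype.card_piFinset, Int.card_Icc, Finset.prod_const, Finset.card_univ]
    have h1 : ((2 : ℤ) ^ k + 1 - -2 ^ k).toNat ≤ 2 ^ (k + 2) := by
      have hk : (1 : ℤ) ≤ 2 ^ k := one_le_pow₀ (by norm_num)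
      rw [Int.toNat_le]
      push_cast
      rw [pow_add]
      linarith
    calc _ ≤ (2 ^ (k + 2)) ^ Fintype.card ι := Nat.pow_le_pow_left h1 _
      _ ≤ (2 ^ (k + 2)) ^ D := Nat.pow_le_pow_right (by positivity) hD
      _ = _ := by rw [← pow_mul]
  · obtain ⟨v, hv, hvw⟩ := hN w hw
    refine ⟨v, hv, ?_⟩
    rw [mul_assoc]
    refine norm_le_of_forall_coord_le hD _ (by positivity) fun c => ?_
    have h1 := Int.abs_sub_lt_one_of_floor_eq_floor (congrFun hvw.symm c)
    have hk : (0 : ℝ) < 2 ^ k := by positivity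
    have h2 : (2 : ℝ) ^ k * ((w c - w₁ c) / R) - 2 ^ k * ((v c - w₁ c) / R) =
        2 ^ k / R * (w - v) c := by
      simp only [PiLp.sub_apply]
      field_simp
      ring
    rw [h2, abs_mul, abs_of_pos (by positivity)] at h1
    calc |(w - v) c| = R * (1 / 2) ^ k * (2 ^ k / R * |(w - v) c|) := by
          rw [one_div, inv_pow]
          field_simp
      _ ≤ R * (1 / 2) ^ k * 1 := by gcongr
      _ = _ := by ring

theorem sum_range_mul_half_pow (K : ℕ) :
    ∑ k ∈ Finset.range K, ((k : ℝ) + 1) * (1 / 2) ^ k = 4 - (2 * K + 4) * (1 / 2) ^ K := by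
  induction K with
  | zero => norm_num
  | succ K ih =>
    rw [Finset.sum_range_succ, ih, pow_succ]
    push_cast
    ring

theorem splitGap_sub {m u : ℕ} (a a' : Fin (m + u) → ℝ) (π : Equiv.Perm (Fin (m + u))) :
    splitGap (fun i => a i - a' i) π = splitGap a π - splitGap a' π := by
  simp only [splitGap, Finset.sum_sub_distrib]
  ring

variable {m u : ℕ} [NeZero m] [NeZero u]

theorem abs_splitGap_le {a : Fin (m + u) → ℝ} {B : ℝ} (ha : ∀ i, |a i| ≤ B)
    (π : Equiv.Perm (Fin (m + u))) : |splitGap a π| ≤ 2 * B := by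
  have key : ∀ (n : ℕ) [NeZero n] (f : Fin n → Fin (m + u)),
      |(1 / (n : ℝ)) * ∑ i, a (f i)| ≤ B := fun n _ f => by
    have hn : (0 : ℝ) < n := by exact_mod_cast NeZero.pos n
    rw [abs_mul, abs_of_pos (by positivity)]
    calc 1 / (n : ℝ) * |∑ i, a (f i)| ≤ 1 / (n : ℝ) * ∑ i, |a (f i)| := by
          gcongr; exact Finset.abs_sum_le_sum_abs _ _
      _ ≤ 1 / (n : ℝ) * ∑ _i : Fin n, B := by gcongr; exact ha _
      _ = B := by simp; field_simp
  calc _ ≤ _ := abs_sub _ _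
    _ ≤ B + B := add_le_add (key u _) (key m _)
    _ = _ := by ring

/-- The constant of the chaining bound in dimension at most `D`. -/
noncomputable def chainConst (D : ℕ) : ℝ := (D + 1) * (8 * √(8 * (10 * D + 9)) + 4)

/-- The union bound at level `k` of the chain: there are at most `2 ^ ((k + 2) D) 2 ^ ((k + 3) D)` links,
and deviations of `√(8 (10 D + 9)) (k + 1) √(log (2 / δ))` standard units are rare enough for the
bounds to be summable over `k`. -/
theorem chaining_level_bound (D k : ℕ) {δ : ℝ} (hδ : 0 < δ) (hδ1 : δ < 1) :
    ((2 : ℝ) ^ ((k + 2) * D) * 2 ^ ((k + 3) * D)) *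
      (2 * Real.exp (-((√(8 * (10 * D + 9)) * (k + 1) * √(Real.log (2 / δ))) ^ 2 / 8))) ≤
      δ * (1 / 2) ^ (k + 4) := by
  have hΛ : Real.log 2 ≤ Real.log (2 / δ) :=
    Real.log_le_log (by norm_num) (by rw [le_div_iff₀ hδ]; linarith)
  have hl2 : 0 < Real.log 2 := Real.log_pos (by norm_num)
  set Λ := Real.log (2 / δ) with hΛdef
  set A : ℕ := (k + 2) * D + (k + 3) * D with hA
  have hsq : (√(8 * (10 * (D : ℝ) + 9)) * (k + 1) * √Λ) ^ 2 / 8 =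
      (10 * D + 9) * (k + 1) ^ 2 * Λ := by
    rw [mul_pow, mul_pow, Real.sq_sqrt (by positivity), Real.sq_sqrt (by linarith)]
    ring
  have hle : ((A + (k + 4) : ℕ) : ℝ) * Real.log 2 + Λ ≤ (10 * D + 9) * (k + 1) ^ 2 * Λ := by
    have hD0 : (0 : ℝ) ≤ D := Nat.cast_nonneg D
    have hk0 : (0 : ℝ) ≤ k := Nat.cast_nonneg k
    have h1 : ((A + (k + 4) : ℕ) : ℝ) ≤ (10 * D + 8) * (k + 1) ^ 2 := by
      rw [hA]; push_cast
      nlinarith [mul_nonneg hD0 hk0, mul_nonneg (mul_nonneg hD0 hk0) hk0, mul_nonneg hk0 hk0]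
    have h2 : Λ ≤ (k + 1) ^ 2 * Λ := by
      have : (0 : ℝ) ≤ Λ := by linarith
      nlinarith [mul_nonneg hk0 this, mul_nonneg (mul_nonneg hk0 hk0) this]
    calc _ ≤ (10 * (D : ℝ) + 8) * (k + 1) ^ 2 * Λ + (k + 1) ^ 2 * Λ := by gcongr
      _ = _ := by ring
  have hexp : Real.exp (-((10 * D + 9) * (k + 1) ^ 2 * Λ)) ≤ (1 / 2) ^ (A + (k + 4)) * (δ / 2) := by
    calc _ ≤ Real.exp (-(((A + (k + 4) : ℕ) : ℝ) * Real.log 2 + Λ)) := by gcongr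
      _ = _ := by
        rw [neg_add, Real.exp_add, Real.exp_neg, Real.exp_neg, Real.exp_nat_mul,
          Real.exp_log (by norm_num), hΛdef, Real.exp_log (by positivity), one_div, inv_pow, inv_div]
  rw [hsq]
  calc _ ≤ ((2 : ℝ) ^ ((k + 2) * D) * 2 ^ ((k + 3) * D)) *
        (2 * ((1 / 2) ^ (A + (k + 4)) * (δ / 2))) := by gcongr
    _ = (2 ^ A * (1 / 2) ^ A) * (δ * (1 / 2) ^ (k + 4)) := by
        rw [← pow_add, ← hA, pow_add (1 / 2 : ℝ) A]; ring
    _ = _ := by rw [← mul_pow]; norm_num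

/-- The uniform deviation bound: outside an event of probability `δ / 8`, the gap at every point of `S`
differs from the gap at `w₁` by at most a multiple of `L R √(log (2 / δ))` times the size factor. -/
theorem prob_exists_gap_gt_le (hD : Fintype.card ι ≤ D) {T : ℕ}
    (ℓ : Fin (m + u) → EuclideanSpace ℝ ι → ℝ) (S : Set (EuclideanSpace ℝ ι))
    (w₁ : EuclideanSpace ℝ ι) (hw₁ : w₁ ∈ S) {R L δ : ℝ} (hR : 0 < R) (hL : 0 ≤ L)
    (hS : ∀ w ∈ S, ‖w - w₁‖ ≤ R)
    (hLip : ∀ i, ∀ w ∈ S, ∀ w' ∈ S, |ℓ i w - ℓ i w'| ≤ L * ‖w - w'‖) (hδ : 0 < δ) (hδ1 : δ < 1) :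
    prob {ω : Outcome m u T | ∃ w ∈ S,
      chainConst D * (L * R * sizeFactor m u * √(Real.log (2 / δ))) <
        |splitGap (fun i => ℓ i w) ω.split - splitGap (fun i => ℓ i w₁) ω.split|} ≤ δ / 8 := by
  classical
  have hΦ : 0 < sizeFactor m u := sizeFactor_pos
  set Φ := sizeFactor m u
  set Λ := Real.log (2 / δ) with hΛ
  set cD := √(8 * (10 * (D : ℝ) + 9)) with hcD
  -- the chain starts at `w₁`
  have hnets : ∃ N : ℕ → Finset (EuclideanSpace ℝ ι), N 0 = {w₁} ∧ ∀ k, (∀ v ∈ N k, v ∈ S) ∧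
      (N k).card ≤ 2 ^ ((k + 2) * D) ∧ ∀ w ∈ S, ∃ v ∈ N k, ‖w - v‖ ≤ (D + 1) * R * (1 / 2) ^ k := by
    choose N hN using exists_net hD S w₁ hR hS
    refine ⟨fun k => if k = 0 then {w₁} else N k, by simp, fun k => ?_⟩
    rcases eq_or_ne k 0 with rfl | hk
    · refine ⟨by simpa using hw₁, by simpa using Nat.one_le_two_pow, fun w hw => ⟨w₁, by simp, ?_⟩⟩
      have := hS w hw
      have hDR : 0 ≤ (D : ℝ) * R := by positivity
      simp only [pow_zero]
      linarith
    · simpa only [if_neg hk] using hN k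
  obtain ⟨N, hN0, hN⟩ := hnets
  -- the depth of the chain: beyond level `K` the Lipschitz bound alone suffices
  obtain ⟨K, hK⟩ := exists_pow_lt_of_lt_one hΦ (by norm_num : (1 / 2 : ℝ) < 1)
  let x : ℕ → ℝ := fun k => cD * (k + 1) * √Λ
  have hx : ∀ k, 0 ≤ x k := fun k => by positivity
  let Bad : ℕ → EuclideanSpace ℝ ι × EuclideanSpace ℝ ι → Set (Outcome m u T) := fun k p =>
    {ω | L * ‖p.2 - p.1‖ * Φ * x k < |splitGap (fun i => ℓ i p.2 - ℓ i p.1) ω.split|}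
  have hsub : {ω : Outcome m u T | ∃ w ∈ S, chainConst D * (L * R * Φ * √Λ) <
      |splitGap (fun i => ℓ i w) ω.split - splitGap (fun i => ℓ i w₁) ω.split|} ⊆
      ⋃ k ∈ Finset.range K, ⋃ p ∈ N k ×ˢ N (k + 1), Bad k p := by
    rintro ω ⟨w, hw, hlt⟩
    by_contra hnot
    simp only [Set.mem_iUnion, not_exists, Bad, Set.mem_ofPred_eq, not_lt] at hnot
    choose v hvN hv using fun k => (hN k).2.2 w hw
    have hv0 : v 0 = w₁ := by simpa [hN0] using hvN 0
    have hvS : ∀ k, v k ∈ S := fun k => (hN k).1 _ (hvN k)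
    let X : EuclideanSpace ℝ ι → ℝ := fun w => splitGap (fun i => ℓ i w) ω.split
    have hstep : ∀ k ∈ Finset.range K, |X (v (k + 1)) - X (v k)| ≤
        2 * (D + 1) * L * R * Φ * cD * √Λ * ((k + 1) * (1 / 2) ^ k) := fun k hk => by
      have h1 := hnot k hk (v k, v (k + 1)) (Finset.mk_mem_product (hvN k) (hvN (k + 1)))
      rw [splitGap_sub] at h1
      refine h1.trans ?_
      have h2 : ‖v (k + 1) - v k‖ ≤ 2 * ((D + 1) * R * (1 / 2) ^ k) := by
        have h3 := norm_sub_le_norm_sub_add_norm_sub (v (k + 1)) w (v k)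
        rw [norm_sub_rev (v (k + 1)) w] at h3
        have h4 := hv (k + 1)
        have h5 := hv k
        have h6 : (D + 1) * R * (1 / 2) ^ (k + 1) ≤ (D + 1) * R * (1 / 2 : ℝ) ^ k := by
          gcongr ?_ * ?_
          exact pow_le_pow_of_le_one (by norm_num) (by norm_num) (Nat.le_succ k)
        linarith
      calc L * ‖v (k + 1) - v k‖ * Φ * x k ≤ L * (2 * ((D + 1) * R * (1 / 2) ^ k)) * Φ * x k := by
            have := hx k
            gcongr
        _ = _ := by simp only [x]; ring
    have hchain : |X (v K) - X w₁| ≤ 2 * (D + 1) * L * R * Φ * cD * √Λ * 4 := by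
      rw [← hv0, ← Finset.sum_range_sub (fun k => X (v k))]
      calc _ ≤ ∑ k ∈ Finset.range K, |X (v (k + 1)) - X (v k)| := Finset.abs_sum_le_sum_abs _ _
        _ ≤ ∑ k ∈ Finset.range K, 2 * (D + 1) * L * R * Φ * cD * √Λ * ((k + 1) * (1 / 2) ^ k) :=
            Finset.sum_le_sum hstep
        _ ≤ _ := by
            rw [← Finset.mul_sum, sum_range_mul_half_pow]
            gcongr
            have : (0 : ℝ) ≤ (2 * K + 4) * (1 / 2) ^ K := by positivity
            linarith
    have hlast : |X w - X (v K)| ≤ 2 * (L * ((D + 1) * R * Φ)) := by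
      simp only [X]
      rw [← splitGap_sub]
      refine abs_splitGap_le (fun i => (hLip i w hw _ (hvS K)).trans ?_) _
      gcongr
      exact (hv K).trans (by gcongr)
    have hΛhalf : 1 / 2 ≤ √Λ := by
      refine Real.le_sqrt_of_sq_le ?_
      have h1 : Real.log 2 ≤ Λ :=
        Real.log_le_log (by norm_num) (by rw [le_div_iff₀ hδ]; linarith)
      have := Real.log_two_gt_d9
      norm_num
      linarith
    have h3 : |X w - X w₁| ≤ |X w - X (v K)| + |X (v K) - X w₁| := abs_sub_le _ _ _
    have h4 : 2 * (L * ((D + 1) * R * Φ)) ≤ 2 * (L * ((D + 1) * R * Φ)) * (2 * √Λ) :=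
      le_mul_of_one_le_right (by positivity) (by linarith)
    have h5 : chainConst D * (L * R * Φ * √Λ) = 2 * (D + 1) * L * R * Φ * cD * √Λ * 4 +
        2 * (L * ((D + 1) * R * Φ)) * (2 * √Λ) := by
      rw [chainConst]; ring
    rw [h5] at hlt
    exact absurd (lt_of_lt_of_le hlt h3) (by linarith)
  refine (prob_mono hsub).trans ((prob_biUnion_le _ _).trans ?_)
  calc ∑ k ∈ Finset.range K, prob (⋃ p ∈ N k ×ˢ N (k + 1), Bad k p)
      ≤ ∑ k ∈ Finset.range K, δ * (1 / 2) ^ (k + 4) := by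
        refine Finset.sum_le_sum fun k _ => (prob_biUnion_le _ _).trans ?_
        calc ∑ p ∈ N k ×ˢ N (k + 1), prob (Bad k p)
            ≤ ∑ _p ∈ N k ×ˢ N (k + 1), 2 * Real.exp (-(x k ^ 2 / 8)) := by
              refine Finset.sum_le_sum fun p hp => ?_
              obtain ⟨h1, h2⟩ := Finset.mem_product.mp hp
              exact prob_splitGap_gt_le _ (fun i => hLip i _ ((hN _).1 _ h2) _ ((hN _).1 _ h1))
                (by positivity) (hx k)
          _ = ((N k).card * (N (k + 1)).card : ℝ) * (2 * Real.exp (-(x k ^ 2 / 8))) := by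
              rw [Finset.sum_const, Finset.card_product, nsmul_eq_mul]; push_cast; ring
          _ ≤ ((2 : ℝ) ^ ((k + 2) * D) * 2 ^ ((k + 3) * D)) * (2 * Real.exp (-(x k ^ 2 / 8))) := by
              gcongr
              · exact_mod_cast (hN k).2.1
              · exact_mod_cast (hN (k + 1)).2.1
          _ ≤ _ := chaining_level_bound D k hδ hδ1
    _ = δ * (1 / 2) ^ 4 * ∑ k ∈ Finset.range K, (1 / 2 : ℝ) ^ k := by
        rw [Finset.mul_sum]
        exact Finset.sum_congr rfl fun k _ => by rw [pow_add]; ring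
    _ ≤ δ * (1 / 2) ^ 4 * 2 := by
        gcongr
        exact sum_geometric_two_le K
    _ = δ / 8 := by ring

end

/-! ### One step of stochastic gradient descent -/

section OneStep

variable {E : Type*} [NormedAddCommGroup E] [InnerProductSpace ℝ E]

/-- The term `η ^ α q` of second order is absorbed in `q` when `η` is small. For large `η`, where
`η ^ α > 1 / (12 PF)`, it is bounded, and hence at most a multiple of `η ^ (1 + α)`. -/
theorem rpow_one_add_mul_le {α PF G η q : ℝ} (hα : 0 < α) (hPF : 0 < PF)
    (hη : 0 < η) (hη1 : η ≤ 1) (hq : 0 ≤ q) (hqG : q ≤ G ^ 2) :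
    3 * PF * (η ^ α * q) ≤
      q / 4 + 3 * PF * G ^ 2 / (1 / (12 * PF)) ^ ((1 + α) / α) * η ^ (1 + α) := by
  have hκ : 0 < (1 / (12 * PF)) ^ ((1 + α) / α) := by positivity
  rcases le_or_gt (η ^ α) (1 / (12 * PF)) with h | h
  · have h1 : 3 * PF * (η ^ α * q) ≤ 3 * PF * (1 / (12 * PF) * q) := by gcongr
    have h2 : 3 * PF * (1 / (12 * PF) * q) = q / 4 := by field_simp; ring
    have h3 : 0 ≤ 3 * PF * G ^ 2 / (1 / (12 * PF)) ^ ((1 + α) / α) * η ^ (1 + α) := by positivity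
    linarith
  · have h1 : (1 / (12 * PF)) ^ ((1 + α) / α) ≤ η ^ (1 + α) := by
      have h2 := Real.rpow_le_rpow (by positivity) h.le (by positivity : 0 ≤ (1 + α) / α)
      rwa [← Real.rpow_mul hη.le, mul_div_cancel₀ _ hα.ne'] at h2
    have h2 : η ^ α ≤ 1 := Real.rpow_le_one hη.le hη1 hα.le
    calc 3 * PF * (η ^ α * q) ≤ 3 * PF * (1 * G ^ 2) := by gcongr
      _ = 3 * PF * G ^ 2 / (1 / (12 * PF)) ^ ((1 + α) / α) *
          (1 / (12 * PF)) ^ ((1 + α) / α) := by field_simp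
      _ ≤ 3 * PF * G ^ 2 / (1 / (12 * PF)) ^ ((1 + α) / α) * η ^ (1 + α) := by gcongr
      _ ≤ _ := by linarith

/-- The parameter of the exponential moments of the training error: small enough for the exponent to
stay in `[-1, 1]` in each step and for the conditional variance to be absorbed in the drift. -/
noncomputable def energyRate (PF G σ₀ : ℝ) : ℝ := 1 / (2 * G ^ 2 + PF * (1 + G ^ 2) + 8 * σ₀ ^ 2)

/-- The conditional exponential moment of the energy grows in one step of size `η` by at most the
exponential of the rate times this constant times `η ^ (1 + α)`. -/
noncomputable def energyDrift (α PF G σ₀ : ℝ) : ℝ :=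
  3 * PF * (1 + σ₀ ^ 2) + 3 * PF * G ^ 2 / (1 / (12 * PF)) ^ ((1 + α) / α)

theorem energyRate_pos {PF G σ₀ : ℝ} (hPF : 0 < PF) : 0 < energyRate PF G σ₀ := by
  unfold energyRate; positivity

theorem energyDrift_pos {α PF G σ₀ : ℝ} (hPF : 0 < PF) : 0 < energyDrift α PF G σ₀ := by
  unfold energyDrift; positivity

/-- A Bernstein-type bound for a centred variable `a` and a nonnegative variable `Y`, in which the
contributions of the variance of `a` and of the mean of `Y` are bounded through `q`. -/
theorem sum_exp_bernstein_le {n : ℕ} (a Y : Fin n → ℝ) {PF G σ₀ q K : ℝ} (hPF : 0 < PF)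
    (hq : 0 ≤ q) (ha0 : ∑ c, a c = 0) (haM : ∀ c, |a c| ≤ 2 * G ^ 2) (hY0 : ∀ c, 0 ≤ Y c)
    (hYM : ∀ c, Y c ≤ PF * (1 + G ^ 2)) (hasq : ∑ c, a c ^ 2 ≤ n * (σ₀ ^ 2 * q))
    (hYsum : 3 * ∑ c, Y c ≤ n * (q / 4 + K)) :
    ∑ c, Real.exp (energyRate PF G σ₀ * (-a c + Y c)) ≤
      n * Real.exp (energyRate PF G σ₀ * (q / 2 + K)) := by
  have hlam0 : 0 < energyRate PF G σ₀ := energyRate_pos hPF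
  have hM0 : 0 < 2 * G ^ 2 + PF * (1 + G ^ 2) := by positivity
  have hlamM : energyRate PF G σ₀ * (2 * G ^ 2 + PF * (1 + G ^ 2) + 8 * σ₀ ^ 2) = 1 := by
    rw [energyRate]; field_simp
  generalize energyRate PF G σ₀ = lam at *
  have hlamM1 : lam * (2 * G ^ 2 + PF * (1 + G ^ 2)) ≤ 1 := by
    nlinarith [mul_nonneg hlam0.le (sq_nonneg σ₀)]
  have hlamσ : lam * (8 * σ₀ ^ 2) ≤ 1 := by nlinarith [mul_nonneg hlam0.le hM0.le]
  -- second-order expansion of the exponential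
  have hpt : ∀ c, Real.exp (lam * (-a c + Y c)) ≤
      1 + (-lam * a c + lam * (3 * Y c)) + 2 * lam ^ 2 * a c ^ 2 := fun c => by
    have hX : |-a c + Y c| ≤ 2 * G ^ 2 + PF * (1 + G ^ 2) := by
      have h1 := abs_add_le (-a c) (Y c)
      rw [abs_neg, abs_of_nonneg (hY0 c)] at h1
      linarith [haM c, hYM c]
    have hX1 : |lam * (-a c + Y c)| ≤ 1 := by
      rw [abs_mul, abs_of_pos hlam0]
      exact (mul_le_mul_of_nonneg_left hX hlam0.le).trans hlamM1
    have h2 := (abs_le.mp (Real.abs_exp_sub_one_sub_id_le hX1)).2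
    have h5 : 0 ≤ lam * Y c := mul_nonneg hlam0.le (hY0 c)
    have h4 : lam * Y c ≤ 1 :=
      (mul_le_mul_of_nonneg_left ((hYM c).trans (by linarith [sq_nonneg G]))
        hlam0.le).trans hlamM1
    have h3 : (lam * Y c) ^ 2 ≤ lam * Y c := by
      rw [sq]; exact mul_le_of_le_one_left h5 h4
    have h6 : (lam * (-a c + Y c)) ^ 2 ≤ 2 * lam ^ 2 * a c ^ 2 + 2 * (lam * Y c) ^ 2 := by
      linarith [sq_nonneg (lam * a c + lam * Y c)]
    linarith
  calc _ ≤ ∑ c, (1 + (-lam * a c + lam * (3 * Y c)) + 2 * lam ^ 2 * a c ^ 2) :=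
        Finset.sum_le_sum fun c _ => hpt c
    _ = n + lam * (3 * ∑ c, Y c) + 2 * lam ^ 2 * ∑ c, a c ^ 2 := by
        rw [Finset.sum_add_distrib, Finset.sum_add_distrib, Finset.sum_add_distrib,
          ← Finset.mul_sum, ← Finset.mul_sum, ← Finset.mul_sum, ← Finset.mul_sum, ha0]
        simp
    _ ≤ n + lam * (n * (q / 4 + K)) + 2 * lam ^ 2 * (n * (σ₀ ^ 2 * q)) := by gcongr
    _ = n + lam * (n * (q / 4 + K)) + (lam * (8 * σ₀ ^ 2)) * (lam * n * q / 4) := by ring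
    _ ≤ n + lam * (n * (q / 4 + K)) + 1 * (lam * n * q / 4) := by gcongr
    _ = n * (lam * (q / 2 + K) + 1) := by ring
    _ ≤ _ := by gcongr; exact Real.add_one_le_exp _

theorem sum_sub_mean_eq_zero {n : ℕ} (g : Fin n → E) (v : E) (hv : ∑ c, g c = (n : ℝ) • v) :
    ∑ c, (g c - v) = 0 := by
  rw [Finset.sum_sub_distrib, hv, Finset.sum_const, Finset.card_univ, Fintype.card_fin,
    ← Nat.cast_smul_eq_nsmul ℝ, sub_self]

theorem sum_norm_sq_le {n : ℕ} (g : Fin n → E) (v : E) (hv : ∑ c, g c = (n : ℝ) • v)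
    {σ₀ : ℝ} (hvar : ∑ c, ‖g c - v‖ ^ 2 ≤ n * σ₀ ^ 2) :
    ∑ c, ‖g c‖ ^ 2 ≤ n * (‖v‖ ^ 2 + σ₀ ^ 2) := by
  have h1 : ∀ c, ‖g c‖ ^ 2 = ‖g c - v‖ ^ 2 + 2 * inner ℝ v (g c - v) + ‖v‖ ^ 2 := fun c => by
    have := norm_add_sq_real v (g c - v)
    rw [add_sub_cancel] at this
    linarith
  have h2 : ∑ c, inner ℝ v (g c - v) = 0 := by
    rw [← inner_sum, sum_sub_mean_eq_zero g v hv, inner_zero_right]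
  rw [Finset.sum_congr rfl fun c _ => h1 c, Finset.sum_add_distrib, Finset.sum_add_distrib,
    ← Finset.mul_sum, h2, Finset.sum_const, Finset.card_univ, Fintype.card_fin, nsmul_eq_mul]
  linarith

/-- The supermartingale inequality for one step of size `η` with stochastic gradients `g c` of mean `v`:
the exponent is the bound of the descent inequality for the change of the training error, plus
`η ‖v‖² / 2`. -/
theorem sum_exp_energy_step_le {n : ℕ} (g : Fin n → E) (v : E) (hv : ∑ c, g c = (n : ℝ) • v)
    {α PF G σ₀ η : ℝ} (hα : 0 < α) (hPF : 0 < PF) (hη : 0 < η) (hη1 : η ≤ 1) (hG : 0 ≤ G)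
    (hg : ∀ c, √η * ‖g c‖ ≤ G) (hvG : √η * ‖v‖ ≤ G) (hvar : ∑ c, ‖g c - v‖ ^ 2 ≤ n * σ₀ ^ 2) :
    ∑ c, Real.exp (energyRate PF G σ₀ * (-(η * inner ℝ v (g c)) +
      PF * η ^ (1 + α) * (1 + ‖g c‖ ^ 2) + η * ‖v‖ ^ 2 / 2)) ≤
      n * Real.exp (energyRate PF G σ₀ * (energyDrift α PF G σ₀ * η ^ (1 + α))) := by
  set q := η * ‖v‖ ^ 2 with hq
  have hsq : √η ^ 2 = η := Real.sq_sqrt hη.le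
  have hq0 : 0 ≤ q := by positivity
  have hsqle : ∀ {x : ℝ}, 0 ≤ x → √η * x ≤ G → η * x ^ 2 ≤ G ^ 2 := fun {x} hx h => by
    calc η * x ^ 2 = (√η * x) ^ 2 := by rw [mul_pow, hsq]
      _ ≤ _ := by gcongr
  have hqG : q ≤ G ^ 2 := hsqle (norm_nonneg v) hvG
  have hηα : η ^ (1 + α) ≤ η := by
    calc η ^ (1 + α) ≤ η ^ (1 : ℝ) := Real.rpow_le_rpow_of_exponent_ge hη hη1 (by linarith)
      _ = η := Real.rpow_one η
  have hη0 : 0 < η ^ (1 + α) := by positivity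
  have hYM : ∀ c, PF * η ^ (1 + α) * (1 + ‖g c‖ ^ 2) ≤ PF * (1 + G ^ 2) := fun c => by
    have h1 := hsqle (norm_nonneg (g c)) (hg c)
    have h2 : η ^ (1 + α) * (1 + ‖g c‖ ^ 2) ≤ 1 + G ^ 2 := by
      calc η ^ (1 + α) * (1 + ‖g c‖ ^ 2) ≤ η * (1 + ‖g c‖ ^ 2) := by gcongr
        _ ≤ _ := by linarith
    rw [mul_assoc]
    gcongr
  have ha0 : ∑ c, η * inner ℝ v (g c - v) = 0 := by
    rw [← Finset.mul_sum, ← inner_sum, sum_sub_mean_eq_zero g v hv, inner_zero_right, mul_zero]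
  have haM : ∀ c, |η * inner ℝ v (g c - v)| ≤ 2 * G ^ 2 := fun c => by
    rw [abs_mul, abs_of_pos hη]
    calc η * |inner ℝ v (g c - v)| ≤ η * (‖v‖ * (‖g c‖ + ‖v‖)) := by
          gcongr
          exact (abs_real_inner_le_norm _ _).trans (by gcongr; exact norm_sub_le _ _)
      _ = (√η * ‖v‖) * (√η * ‖g c‖ + √η * ‖v‖) := by
          linear_combination (-(‖v‖ * (‖g c‖ + ‖v‖))) * hsq
      _ ≤ G * (G + G) := by
          have := hg c
          gcongr
      _ = _ := by ring
  have hasq : ∑ c, (η * inner ℝ v (g c - v)) ^ 2 ≤ n * (σ₀ ^ 2 * q) := by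
    calc _ ≤ ∑ c, η * q * ‖g c - v‖ ^ 2 := by
          refine Finset.sum_le_sum fun c _ => ?_
          have h1 : inner ℝ v (g c - v) ^ 2 ≤ (‖v‖ * ‖g c - v‖) ^ 2 :=
            sq_le_sq' (neg_le_of_abs_le (abs_real_inner_le_norm _ _))
              (le_of_abs_le (abs_real_inner_le_norm _ _))
          calc (η * inner ℝ v (g c - v)) ^ 2 = η ^ 2 * inner ℝ v (g c - v) ^ 2 := mul_pow _ _ _
            _ ≤ η ^ 2 * (‖v‖ * ‖g c - v‖) ^ 2 := mul_le_mul_of_nonneg_left h1 (sq_nonneg η)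
            _ = _ := by rw [hq]; ring
      _ ≤ η * q * (n * σ₀ ^ 2) := by rw [← Finset.mul_sum]; gcongr
      _ ≤ 1 * q * (n * σ₀ ^ 2) := by gcongr
      _ = _ := by ring
  have hYsum : 3 * ∑ c, PF * η ^ (1 + α) * (1 + ‖g c‖ ^ 2) ≤
      n * (q / 4 + energyDrift α PF G σ₀ * η ^ (1 + α)) := by
    have hgsq := sum_norm_sq_le g v hv hvar
    have h1 : ∑ c, (1 + ‖g c‖ ^ 2) ≤ n * (1 + σ₀ ^ 2 + ‖v‖ ^ 2) := by
      rw [Finset.sum_add_distrib, Finset.sum_const, Finset.card_univ, Fintype.card_fin,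
        nsmul_eq_mul]
      linarith
    have h2 := rpow_one_add_mul_le hα hPF hη hη1 hq0 hqG
    have h3 : η ^ (1 + α) * ‖v‖ ^ 2 = η ^ α * q := by
      rw [add_comm, Real.rpow_add hη, Real.rpow_one, hq]; ring
    rw [← Finset.mul_sum]
    calc _ ≤ 3 * (PF * η ^ (1 + α) * (n * (1 + σ₀ ^ 2 + ‖v‖ ^ 2))) := by gcongr
      _ = n * (3 * PF * (1 + σ₀ ^ 2) * η ^ (1 + α) + 3 * PF * (η ^ (1 + α) * ‖v‖ ^ 2)) := by ring
      _ ≤ n * (3 * PF * (1 + σ₀ ^ 2) * η ^ (1 + α) + (q / 4 +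
          3 * PF * G ^ 2 / (1 / (12 * PF)) ^ ((1 + α) / α) * η ^ (1 + α))) := by rw [h3]; gcongr
      _ = _ := by rw [energyDrift]; ring
  have hsum := sum_exp_bernstein_le (σ₀ := σ₀) _ _ hPF hq0 ha0 haM (fun c => by positivity)
    hYM hasq hYsum
  have hsplit : ∀ c, energyRate PF G σ₀ *
      (-(η * inner ℝ v (g c)) + PF * η ^ (1 + α) * (1 + ‖g c‖ ^ 2) + q / 2) =
      energyRate PF G σ₀ * (-(η * inner ℝ v (g c - v)) + PF * η ^ (1 + α) * (1 + ‖g c‖ ^ 2)) +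
        -(energyRate PF G σ₀ * (q / 2)) := fun c => by
    rw [inner_sub_right, real_inner_self_eq_norm_sq, hq]
    ring
  rw [Finset.sum_congr rfl fun c _ => by rw [hsplit c, Real.exp_add], ← Finset.sum_mul]
  calc _ ≤ n * Real.exp (energyRate PF G σ₀ * (q / 2 + energyDrift α PF G σ₀ * η ^ (1 + α))) *
        Real.exp (-(energyRate PF G σ₀ * (q / 2))) := by gcongr
    _ = _ := by
        rw [mul_assoc, ← Real.exp_add]
        congr 2
        ring

variable [CompleteSpace E]

/-- The descent inequality, from the mean value theorem. -/
theorem sub_le_inner_gradient_add {f : E → ℝ} (hf : Differentiable ℝ f) {S : Set E}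
    (hS : Convex ℝ S) {PF α : ℝ} (hα : 0 ≤ α) (hPF : 0 ≤ PF)
    (hH : ∀ w ∈ S, ∀ w' ∈ S,
      ‖gradient f w - gradient f w'‖ ≤ PF * max (‖w - w'‖ ^ α) ‖w - w'‖)
    {w w' : E} (hw : w ∈ S) (hw' : w' ∈ S) :
    f w' - f w ≤ inner ℝ (gradient f w) (w' - w) +
      PF * max (‖w' - w‖ ^ α) ‖w' - w‖ * ‖w' - w‖ := by
  obtain ⟨z, hz, hzf⟩ := domain_mvt (f := f) (f' := fun z => fderiv ℝ f z)
    (fun z _ => (hf z).hasFDerivAt.hasFDerivWithinAt) hS hw hw'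
  have hzS : z ∈ S := hS.segment_subset hw hw' hz
  have hin : fderiv ℝ f z (w' - w) = inner ℝ (gradient f z) (w' - w) := by
    rw [gradient, InnerProductSpace.toDual_symm_apply]
  have hzw : ‖z - w‖ ≤ ‖w' - w‖ := by
    obtain ⟨a, b, ha, hb, hab, rfl⟩ := hz
    have : a • w + b • w' - w = b • (w' - w) := by
      rw [smul_sub, ← sub_eq_zero]
      have : a = 1 - b := by linarith
      subst this
      module
    rw [this, norm_smul, Real.norm_of_nonneg hb]
    exact mul_le_of_le_one_left (norm_nonneg _) (by linarith)
  rw [hzf, hin]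
  have h1 : inner ℝ (gradient f z) (w' - w) =
      inner ℝ (gradient f w) (w' - w) + inner ℝ (gradient f z - gradient f w) (w' - w) := by
    rw [inner_sub_left]; ring
  rw [h1]
  gcongr
  refine (real_inner_le_norm _ _).trans ?_
  gcongr
  exact (hH z hzS w hw).trans (by gcongr)

theorem max_rpow_mul_le {α η x : ℝ} (hα : 0 ≤ α) (hα1 : α ≤ 1) (hη : 0 < η) (hη1 : η ≤ 1)
    (hx : 0 ≤ x) : max ((η * x) ^ α) (η * x) * (η * x) ≤ η ^ (1 + α) * (1 + x ^ 2) := by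
  have hη2 : η ^ 2 ≤ η ^ (1 + α) := by
    rw [← Real.rpow_natCast]
    exact Real.rpow_le_rpow_of_exponent_ge hη hη1 (by push_cast; linarith)
  rw [max_mul_of_nonneg _ _ (by positivity)]
  refine max_le ?_ ?_
  · have hxα : x ^ α * x ≤ 1 + x ^ 2 := by
      rcases le_total x 1 with h | h
      · have : x ^ α ≤ 1 := Real.rpow_le_one hx h hα
        nlinarith [sq_nonneg x]
      · have : x ^ α ≤ x := by
          simpa using Real.rpow_le_rpow_of_exponent_le h hα1
        nlinarith
    calc (η * x) ^ α * (η * x) = η ^ (1 + α) * (x ^ α * x) := by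
          rw [Real.mul_rpow hη.le hx, Real.rpow_add hη, Real.rpow_one]; ring
      _ ≤ _ := by gcongr
  · calc η * x * (η * x) = η ^ 2 * x ^ 2 := by ring
      _ ≤ η ^ (1 + α) * (1 + x ^ 2) := by gcongr; linarith

end OneStep

/-! ### The SGD process -/

theorem norm_average_le {E : Type*} [NormedAddCommGroup E] [InnerProductSpace ℝ E] {m : ℕ} [NeZero m]
    {x : Fin m → E} {B : ℝ} (h : ∀ i, ‖x i‖ ≤ B) :
    ‖(1 / (m : ℝ)) • ∑ i, x i‖ ≤ B := by
  have hm : (0 : ℝ) < m := by exact_mod_cast NeZero.pos m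
  rw [norm_smul, Real.norm_of_nonneg (by positivity)]
  calc 1 / (m : ℝ) * ‖∑ i, x i‖ ≤ 1 / (m : ℝ) * ∑ _i : Fin m, B := by
        gcongr; exact (norm_sum_le _ _).trans (Finset.sum_le_sum fun i _ => h i)
    _ = B := by simp; field_simp

theorem differentiable_trainErr {E : Type*} [NormedAddCommGroup E] [InnerProductSpace ℝ E]
    {m u : ℕ} {ℓ : Fin (m + u) → E → ℝ} (hℓ : ∀ i, Differentiable ℝ (ℓ i))
    (π : Equiv.Perm (Fin (m + u))) :
    Differentiable ℝ (trainErr ℓ π) := by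
  unfold trainErr
  fun_prop

section Iterates

variable {m u T : ℕ} {E : Type*} [NormedAddCommGroup E] [InnerProductSpace ℝ E] [CompleteSpace E]

/-- The outcome in which draw `t` is replaced by `c`. -/
def Outcome.redraw (ω : Outcome m u T) (t : Fin T) (c : Fin m) : Outcome m u T :=
  ⟨ω.split, Function.update ω.draw t c⟩

/-- Drawing step `t` again does not change the distribution of the outcome. -/
theorem sum_redraw (t : Fin T) (F : Outcome m u T → ℝ) :
    ∑ ω : Outcome m u T, ∑ c, F (ω.redraw t c) = m * ∑ ω, F ω := by
  -- exchanging draw `t` with an independent copy is an involution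
  let e : Outcome m u T × Fin m → Outcome m u T × Fin m := fun x => (x.1.redraw t x.2, x.1.draw t)
  have he : Function.Involutive e := fun ⟨⟨π, d⟩, c⟩ => by simp [e, Outcome.redraw]
  rw [← Fintype.sum_prod_type' (f := fun (ω : Outcome m u T) c => F (ω.redraw t c))]
  calc _ = ∑ x : Outcome m u T × Fin m, F (he.toPerm e x).1 := rfl
    _ = ∑ x : Outcome m u T × Fin m, F x.1 := Equiv.sum_comp (he.toPerm e) fun x => F x.1
    _ = _ := by
      rw [Fintype.sum_prod_type]
      simp [Finset.mul_sum]

/-- An exponential supermartingale inequality. The process `f` need not be adapted explicitly: the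
hypothesis averages `f (t + 1)` over a new value of draw `t`. -/
theorem sum_exp_le_of_forall_redraw [NeZero m] (f : ℕ → Outcome m u T → ℝ) (b : ℕ → ℝ)
    (h0 : ∀ ω, f 0 ω = 0)
    (hstep : ∀ (t : ℕ) (h : t < T) (ω : Outcome m u T),
      ∑ c, Real.exp (f (t + 1) (ω.redraw ⟨t, h⟩ c)) ≤ m * Real.exp (f t ω + b t)) :
    ∀ t ≤ T, ∑ ω, Real.exp (f t ω) ≤
      Fintype.card (Outcome m u T) * Real.exp (∑ s ∈ Finset.range t, b s) := by
  intro t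
  induction t with
  | zero => intro _; simp [h0]
  | succ t ih =>
    intro ht
    have hm : (0 : ℝ) < m := by exact_mod_cast NeZero.pos m
    have h1 := sum_redraw (⟨t, ht⟩ : Fin T) fun ω => Real.exp (f (t + 1) ω)
    refine le_of_mul_le_mul_left ?_ hm
    rw [← h1]
    calc _ ≤ ∑ ω, m * Real.exp (f t ω + b t) := Finset.sum_le_sum fun ω _ => hstep t ht ω
      _ = m * ((∑ ω, Real.exp (f t ω)) * Real.exp (b t)) := by
          simp only [Real.exp_add, ← Finset.mul_sum, ← Finset.sum_mul]
      _ ≤ m * (Fintype.card (Outcome m u T) * Real.exp (∑ s ∈ Finset.range t, b s) *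
            Real.exp (b t)) := by
          gcongr
          exact ih (Nat.le_of_succ_le ht)
      _ = _ := by rw [Finset.sum_range_succ, Real.exp_add]; ring

variable (ℓ : Fin (m + u) → E → ℝ) (w₁ : E) (t₀ : ℝ)

/-- The stochastic gradient used by SGD in step `t`; zero after the last step. -/
noncomputable def stochGrad (ω : Outcome m u T) (t : ℕ) : E :=
  if h : t < T then
    gradient (ℓ (ω.split (Fin.castAdd u (ω.draw ⟨t, h⟩)))) (sgd ℓ w₁ t₀ ω t)
  else 0

/-- The average over the training nodes of the gradients of the loss. -/
noncomputable def trainGrad (π : Equiv.Perm (Fin (m + u))) (w : E) : E :=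
  (1 / (m : ℝ)) • ∑ i : Fin m, gradient (ℓ (π (Fin.castAdd u i))) w

theorem sgd_succ (ω : Outcome m u T) (t : ℕ) :
    sgd ℓ w₁ t₀ ω (t + 1) =
      sgd ℓ w₁ t₀ ω t - learningRate t₀ (t + 1) • stochGrad ℓ w₁ t₀ ω t := by
  rw [sgd, stochGrad]
  split_ifs <;> simp

theorem sgd_redraw (ω : Outcome m u T) {t : ℕ} (h : t < T) (c : Fin m) :
    ∀ s ≤ t, sgd ℓ w₁ t₀ (ω.redraw ⟨t, h⟩ c) s = sgd ℓ w₁ t₀ ω s := by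
  intro s
  induction s with
  | zero => intro _; rfl
  | succ s ih =>
    intro hs
    have hsT : s < T := by omega
    rw [sgd, sgd, dif_pos hsT, dif_pos hsT, ih (by omega)]
    have hne : (⟨s, hsT⟩ : Fin T) ≠ ⟨t, h⟩ := by
      simp only [ne_eq, Fin.mk.injEq]; omega
    simp [Outcome.redraw, Function.update_of_ne hne]

theorem stochGrad_redraw_of_lt (ω : Outcome m u T) {t : ℕ} (h : t < T) (c : Fin m) {s : ℕ}
    (hs : s < t) : stochGrad ℓ w₁ t₀ (ω.redraw ⟨t, h⟩ c) s = stochGrad ℓ w₁ t₀ ω s := by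
  have hsT : s < T := by omega
  have hne : (⟨s, hsT⟩ : Fin T) ≠ ⟨t, h⟩ := by
    simp only [ne_eq, Fin.mk.injEq]; omega
  rw [stochGrad, stochGrad, dif_pos hsT, dif_pos hsT, sgd_redraw ℓ w₁ t₀ ω h c s hs.le]
  simp [Outcome.redraw, Function.update_of_ne hne]

theorem stochGrad_redraw_self (ω : Outcome m u T) {t : ℕ} (h : t < T) (c : Fin m) :
    stochGrad ℓ w₁ t₀ (ω.redraw ⟨t, h⟩ c) t =
      gradient (ℓ (ω.split (Fin.castAdd u c))) (sgd ℓ w₁ t₀ ω t) := by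
  rw [stochGrad, dif_pos h, sgd_redraw ℓ w₁ t₀ ω h c t le_rfl]
  simp [Outcome.redraw]

/-- The stochastic gradient of step `t` minus its mean over the training nodes. -/
noncomputable def gradNoise (ω : Outcome m u T) (t : ℕ) : E :=
  stochGrad ℓ w₁ t₀ ω t - trainGrad ℓ ω.split (sgd ℓ w₁ t₀ ω t)

theorem gradNoise_redraw_of_lt (ω : Outcome m u T) {t : ℕ} (h : t < T) (c : Fin m) {s : ℕ}
    (hs : s < t) : gradNoise ℓ w₁ t₀ (ω.redraw ⟨t, h⟩ c) s = gradNoise ℓ w₁ t₀ ω s := by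
  rw [gradNoise, gradNoise, stochGrad_redraw_of_lt ℓ w₁ t₀ ω h c hs,
    sgd_redraw ℓ w₁ t₀ ω h c s hs.le]
  rfl

theorem gradNoise_redraw_self (ω : Outcome m u T) {t : ℕ} (h : t < T) (c : Fin m) :
    gradNoise ℓ w₁ t₀ (ω.redraw ⟨t, h⟩ c) t =
      gradient (ℓ (ω.split (Fin.castAdd u c))) (sgd ℓ w₁ t₀ ω t) -
        trainGrad ℓ ω.split (sgd ℓ w₁ t₀ ω t) := by
  rw [gradNoise, stochGrad_redraw_self, sgd_redraw ℓ w₁ t₀ ω h c t le_rfl]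
  rfl

theorem sgd_sub_eq (ω : Outcome m u T) (t : ℕ) :
    sgd ℓ w₁ t₀ ω t - w₁ =
      -(∑ s ∈ Finset.range t, learningRate t₀ (s + 1) •
          trainGrad ℓ ω.split (sgd ℓ w₁ t₀ ω s)) -
        ∑ s ∈ Finset.range t, learningRate t₀ (s + 1) • gradNoise ℓ w₁ t₀ ω s := by
  induction t with
  | zero => simp [sgd]
  | succ t ih =>
    rw [sgd_succ, Finset.sum_range_succ, Finset.sum_range_succ, sub_right_comm, ih, gradNoise,
      smul_sub]
    abel

variable {ℓ}

theorem sum_gradient_eq [NeZero m] (π : Equiv.Perm (Fin (m + u))) (w : E) :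
    ∑ i : Fin m, gradient (ℓ (π (Fin.castAdd u i))) w = (m : ℝ) • trainGrad ℓ π w := by
  have hm : (m : ℝ) ≠ 0 := by exact_mod_cast NeZero.ne m
  rw [trainGrad, smul_smul, mul_one_div_cancel hm, one_smul]

theorem gradient_trainErr (hℓ : ∀ i, Differentiable ℝ (ℓ i)) (π : Equiv.Perm (Fin (m + u)))
    (w : E) : gradient (trainErr ℓ π) w = trainGrad ℓ π w := by
  have h : HasFDerivAt (trainErr ℓ π)
      ((1 / (m : ℝ)) • ∑ i : Fin m, fderiv ℝ (ℓ (π (Fin.castAdd u i))) w) w := by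
    unfold trainErr
    exact (HasFDerivAt.fun_sum fun i _ => (hℓ _ w).hasFDerivAt).const_mul _
  rw [gradient, h.fderiv, map_smul, map_sum]
  rfl

theorem learningRate_pos {t₀ : ℝ} (ht₀ : 1 ≤ t₀) (t : ℕ) : 0 < learningRate t₀ t := by
  unfold learningRate; positivity

theorem learningRate_succ_le {t₀ : ℝ} (ht₀ : 1 ≤ t₀) (t : ℕ) :
    learningRate t₀ (t + 1) ≤ 1 / ((t : ℝ) + 2) := by
  unfold learningRate
  push_cast
  exact one_div_le_one_div_of_le (by positivity) (by linarith)

theorem learningRate_succ_le_one {t₀ : ℝ} (ht₀ : 1 ≤ t₀) (t : ℕ) :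
    learningRate t₀ (t + 1) ≤ 1 := by
  refine (learningRate_succ_le ht₀ t).trans ?_
  rw [div_le_one (by positivity)]
  have : (0 : ℝ) ≤ t := Nat.cast_nonneg t
  linarith

theorem sum_learningRate_le {t₀ : ℝ} (ht₀ : 1 ≤ t₀) {T : ℕ} (hT : 2 ≤ T) :
    ∑ s ∈ Finset.range T, learningRate t₀ (s + 1) ≤ 2 * Real.log T := by
  have h : ∀ t : ℕ, ∑ s ∈ Finset.range t, learningRate t₀ (s + 1) ≤ Real.log (t + 1) := by
    intro t
    induction t with
    | zero => simp
    | succ t ih =>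
      rw [Finset.sum_range_succ]
      have ht : (0 : ℝ) < (t : ℝ) + 1 := by positivity
      have h1 := Real.one_sub_inv_le_log_of_pos (x := ((t : ℝ) + 2) / (t + 1)) (by positivity)
      rw [Real.log_div (by positivity) ht.ne'] at h1
      have h2 : 1 - (((t : ℝ) + 2) / (t + 1))⁻¹ = 1 / ((t : ℝ) + 2) := by
        rw [inv_div]; field_simp; ring
      have h3 := learningRate_succ_le ht₀ t
      have h4 : ((t + 1 : ℕ) : ℝ) + 1 = (t : ℝ) + 2 := by push_cast; ring
      rw [h4]
      linarith
  have hT' : (2 : ℝ) ≤ T := by exact_mod_cast hT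
  calc _ ≤ Real.log (T + 1) := h T
    _ ≤ Real.log (T ^ 2) := Real.log_le_log (by positivity) (by nlinarith)
    _ = _ := by rw [Real.log_pow]; norm_num

/-- The series `∑ n ^ -(1 + α)`, which bounds every partial sum of `η_t ^ (1 + α)`. -/
noncomputable def rateSum (α : ℝ) : ℝ := ∑' n : ℕ, 1 / ((n : ℝ) + 1) ^ (1 + α)

theorem sum_learningRate_rpow_le {α t₀ : ℝ} (hα : 0 < α) (ht₀ : 1 ≤ t₀) (T : ℕ) :
    ∑ s ∈ Finset.range T, learningRate t₀ (s + 1) ^ (1 + α) ≤ rateSum α := by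
  have hs : Summable fun n : ℕ => 1 / ((n : ℝ) + 1) ^ (1 + α) := by
    have := (summable_nat_add_iff 1).mpr
      (Real.summable_one_div_nat_rpow.mpr (by linarith : 1 < 1 + α))
    simpa using this
  calc _ ≤ ∑ s ∈ Finset.range T, 1 / ((s : ℝ) + 1) ^ (1 + α) := by
        refine Finset.sum_le_sum fun s _ => ?_
        have h1 : learningRate t₀ (s + 1) ≤ 1 / ((s : ℝ) + 1) :=
          (learningRate_succ_le ht₀ s).trans
            (one_div_le_one_div_of_le (by positivity) (by linarith))
        calc _ ≤ (1 / ((s : ℝ) + 1)) ^ (1 + α) :=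
              Real.rpow_le_rpow (learningRate_pos ht₀ _).le h1 (by linarith)
          _ = _ := by rw [Real.div_rpow (by norm_num) (by positivity), Real.one_rpow]
    _ ≤ _ := hs.sum_le_tsum _ fun n _ => by positivity

theorem rateSum_nonneg (α : ℝ) : 0 ≤ rateSum α := tsum_nonneg fun n => by positivity

/-- The exponential moment of the energy: the increase of the training error plus half of the sum of
`η_t ‖∇R_m(w^{(t)})‖²`. -/
theorem sum_exp_energy_le [NeZero m] {w₁ : E} {t₀ r α PF G σ₀ : ℝ} (hα : 0 < α) (hα1 : α ≤ 1)
    (hPF : 0 < PF) (hG : 0 < G) (ht₀ : 1 ≤ t₀) (hℓ : ∀ i, Differentiable ℝ (ℓ i))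
    (hH : ∀ i, ∀ w ∈ Metric.closedBall w₁ r, ∀ w' ∈ Metric.closedBall w₁ r,
      ‖gradient (ℓ i) w - gradient (ℓ i) w'‖ ≤ PF * max (‖w - w'‖ ^ α) ‖w - w'‖)
    (hball : IteratesInBall T ℓ w₁ t₀ r) (hgrad : BoundedScaledGradients T ℓ w₁ t₀ G)
    (hvar : BoundedGradientVariance T ℓ w₁ t₀ σ₀) :
    ∑ ω : Outcome m u T, Real.exp (energyRate PF G σ₀ *
      (trainErr ℓ ω.split (sgd ℓ w₁ t₀ ω T) - trainErr ℓ ω.split w₁ +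
        (∑ s ∈ Finset.range T, learningRate t₀ (s + 1) *
          ‖trainGrad ℓ ω.split (sgd ℓ w₁ t₀ ω s)‖ ^ 2) / 2)) ≤
      Fintype.card (Outcome m u T) *
        Real.exp (energyRate PF G σ₀ * (energyDrift α PF G σ₀ * rateSum α)) := by
  have hm : (0 : ℝ) < m := by exact_mod_cast NeZero.pos m
  have hlam0 : 0 < energyRate PF G σ₀ := energyRate_pos hPF
  have hdr : 0 < energyDrift α PF G σ₀ := energyDrift_pos hPF
  set lam := energyRate PF G σ₀
  set C := energyDrift α PF G σ₀
  refine (sum_exp_le_of_forall_redraw (fun t ω => lam *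
      (trainErr ℓ ω.split (sgd ℓ w₁ t₀ ω t) - trainErr ℓ ω.split w₁ +
        (∑ s ∈ Finset.range t, learningRate t₀ (s + 1) *
          ‖trainGrad ℓ ω.split (sgd ℓ w₁ t₀ ω s)‖ ^ 2) / 2))
      (fun t => lam * (C * learningRate t₀ (t + 1) ^ (1 + α)))
      (fun ω => by simp [sgd]) ?_ T le_rfl).trans ?_
  · intro t ht ω
    set η := learningRate t₀ (t + 1) with hη
    have hη0 : 0 < η := learningRate_pos ht₀ _
    have hη1 : η ≤ 1 := learningRate_succ_le_one ht₀ t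
    set w := sgd ℓ w₁ t₀ ω t with hw
    set v := trainGrad ℓ ω.split w with hv
    let g : Fin m → E := fun c => gradient (ℓ (ω.split (Fin.castAdd u c))) w
    have hgv : ∑ c, g c = (m : ℝ) • v := sum_gradient_eq ω.split w
    have hg : ∀ c, √η * ‖g c‖ ≤ G := fun c => hgrad ω t ht _
    have hsη : 0 < √η := Real.sqrt_pos.mpr hη0
    have hvG : √η * ‖v‖ ≤ G := by
      rw [mul_comm, ← le_div_iff₀ hsη]
      refine norm_average_le fun c => ?_
      rw [le_div_iff₀ hsη, mul_comm]
      exact hg c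
    have hvar' : ∑ c, ‖g c - v‖ ^ 2 ≤ m * σ₀ ^ 2 := by
      have h1 := hvar ω t ht
      rw [gradient_trainErr hℓ, one_div, inv_mul_le_iff₀ hm] at h1
      exact h1
    have hstep := sum_exp_energy_step_le g v hgv hα hPF hη0 hη1 hG.le hg hvG hvar'
    set A := trainErr ℓ ω.split w - trainErr ℓ ω.split w₁ +
        (∑ s ∈ Finset.range t, learningRate t₀ (s + 1) *
          ‖trainGrad ℓ ω.split (sgd ℓ w₁ t₀ ω s)‖ ^ 2) / 2 with hA
    have hred : ∀ c, trainErr ℓ ω.split (sgd ℓ w₁ t₀ (ω.redraw ⟨t, ht⟩ c) (t + 1)) -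
        trainErr ℓ ω.split w₁ + (∑ s ∈ Finset.range (t + 1), learningRate t₀ (s + 1) *
          ‖trainGrad ℓ ω.split (sgd ℓ w₁ t₀ (ω.redraw ⟨t, ht⟩ c) s)‖ ^ 2) / 2 ≤
        A + (-(η * inner ℝ v (g c)) + PF * η ^ (1 + α) * (1 + ‖g c‖ ^ 2) + η * ‖v‖ ^ 2 / 2) := by
      intro c
      have hsum : ∑ s ∈ Finset.range (t + 1), learningRate t₀ (s + 1) *
          ‖trainGrad ℓ ω.split (sgd ℓ w₁ t₀ (ω.redraw ⟨t, ht⟩ c) s)‖ ^ 2 =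
          ∑ s ∈ Finset.range t, learningRate t₀ (s + 1) *
          ‖trainGrad ℓ ω.split (sgd ℓ w₁ t₀ ω s)‖ ^ 2 + η * ‖v‖ ^ 2 := by
        rw [Finset.sum_range_succ, sgd_redraw ℓ w₁ t₀ ω ht c t le_rfl]
        congr 1
        refine Finset.sum_congr rfl fun s hs => ?_
        rw [sgd_redraw ℓ w₁ t₀ ω ht c s (Finset.mem_range.mp hs).le]
      have hnext : sgd ℓ w₁ t₀ (ω.redraw ⟨t, ht⟩ c) (t + 1) = w - η • g c := by
        rw [sgd_succ, stochGrad_redraw_self, sgd_redraw ℓ w₁ t₀ ω ht c t le_rfl]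
      have hmem : w - η • g c ∈ Metric.closedBall w₁ r := by
        rw [← hnext]; exact hball _ _ ht
      have hHR : ∀ x ∈ Metric.closedBall w₁ r, ∀ x' ∈ Metric.closedBall w₁ r,
          ‖gradient (trainErr ℓ ω.split) x - gradient (trainErr ℓ ω.split) x'‖ ≤
            PF * max (‖x - x'‖ ^ α) ‖x - x'‖ := fun x hx x' hx' => by
        rw [gradient_trainErr hℓ, gradient_trainErr hℓ, trainGrad, trainGrad, ← smul_sub,
          ← Finset.sum_sub_distrib]
        exact norm_average_le fun i => hH _ x hx x' hx'
      have hdesc := sub_le_inner_gradient_add (differentiable_trainErr hℓ ω.split)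
        (convex_closedBall w₁ r) hα.le hPF.le hHR (hball ω t ht.le) hmem
      rw [gradient_trainErr hℓ, ← hw, ← hv, sub_sub_cancel_left, norm_neg, norm_smul,
        Real.norm_of_nonneg hη0.le, inner_neg_right, inner_smul_right] at hdesc
      have hmax := max_rpow_mul_le hα.le hα1 hη0 hη1 (norm_nonneg (g c))
      have hmax' := mul_le_mul_of_nonneg_left hmax hPF.le
      rw [hsum, hnext, hA]
      linarith
    calc _ ≤ ∑ c, Real.exp (lam * A) * Real.exp (lam * (-(η * inner ℝ v (g c)) +
          PF * η ^ (1 + α) * (1 + ‖g c‖ ^ 2) + η * ‖v‖ ^ 2 / 2)) := by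
          refine Finset.sum_le_sum fun c _ => ?_
          rw [← Real.exp_add, ← mul_add]
          exact Real.exp_le_exp.mpr (mul_le_mul_of_nonneg_left (hred c) hlam0.le)
      _ ≤ Real.exp (lam * A) * (m * Real.exp (lam * (C * η ^ (1 + α)))) := by
          rw [← Finset.mul_sum]; gcongr
      _ = _ := by rw [Real.exp_add]; ring
  · gcongr
    rw [← Finset.mul_sum, ← Finset.mul_sum]
    gcongr
    exact sum_learningRate_rpow_le hα ht₀ T

end Iterates

section Noise

variable {m u T : ℕ} [NeZero m] {ι : Type*} [Fintype ι] {ℓ : Fin (m + u) → EuclideanSpace ℝ ι → ℝ}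

/-- The Azuma–Hoeffding bound for one coordinate of the weighted sum of the gradient noise. -/
theorem sum_exp_noise_le {w₁ : EuclideanSpace ℝ ι} {t₀ G : ℝ} (hG : 0 < G) (ht₀ : 1 ≤ t₀)
    (hT : 2 ≤ T) (hgrad : BoundedScaledGradients T ℓ w₁ t₀ G) (i : ι) (θ : ℝ) :
    ∑ ω : Outcome m u T, Real.exp (θ *
      (∑ s ∈ Finset.range T, learningRate t₀ (s + 1) * gradNoise ℓ w₁ t₀ ω s i)) ≤
      Fintype.card (Outcome m u T) *
        Real.exp (2 * θ ^ 2 * (G * √(2 * Real.log T)) ^ 2) := by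
  have hm : (0 : ℝ) < m := by exact_mod_cast NeZero.pos m
  have hlog : 0 ≤ Real.log T := Real.log_natCast_nonneg T
  refine (sum_exp_le_of_forall_redraw (fun t ω => θ *
      (∑ s ∈ Finset.range t, learningRate t₀ (s + 1) * gradNoise ℓ w₁ t₀ ω s i))
      (fun t => 2 * θ ^ 2 * G ^ 2 * learningRate t₀ (t + 1)) (fun ω => by simp) ?_ T le_rfl).trans ?_
  · intro t ht ω
    set η := learningRate t₀ (t + 1) with hη
    have hη0 : 0 < η := learningRate_pos ht₀ _
    have hsq : √η * √η = η := Real.mul_self_sqrt hη0.le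
    set w := sgd ℓ w₁ t₀ ω t with hw
    set v := trainGrad ℓ ω.split w with hv
    let g : Fin m → EuclideanSpace ℝ ι := fun c => gradient (ℓ (ω.split (Fin.castAdd u c))) w
    have hgv : ∑ c, g c = (m : ℝ) • v := sum_gradient_eq ω.split w
    have hg : ∀ c, √η * ‖g c‖ ≤ G := fun c => hgrad ω t ht _
    have hsη : 0 < √η := Real.sqrt_pos.mpr hη0
    have hvG : √η * ‖v‖ ≤ G := by
      rw [mul_comm, ← le_div_iff₀ hsη]
      refine norm_average_le fun c => ?_
      rw [le_div_iff₀ hsη, mul_comm]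
      exact hg c
    let x : Fin m → ℝ := fun c => θ * (η * (g c - v) i)
    have hx0 : ∑ c, x c = 0 := by
      have h1 : ∑ c, (g c - v) = 0 := sum_sub_mean_eq_zero g v hgv
      have h2 : ∑ c, (g c - v) i = 0 := by
        have h3 := congrArg (fun y : EuclideanSpace ℝ ι => y i) h1
        simpa using h3
      simp only [x]
      rw [← Finset.mul_sum, ← Finset.mul_sum, h2]
      simp
    have hxb : ∀ c, |x c| ≤ |θ| * (√η * (2 * G)) := fun c => by
      simp only [x, abs_mul, abs_of_pos hη0]
      refine mul_le_mul_of_nonneg_left ?_ (abs_nonneg θ)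
      calc η * |(g c - v) i| ≤ η * ‖g c - v‖ := by
            gcongr; exact PiLp.norm_apply_le (g c - v) i
        _ ≤ η * (‖g c‖ + ‖v‖) := by gcongr; exact norm_sub_le _ _
        _ = √η * (√η * ‖g c‖ + √η * ‖v‖) := by
            linear_combination (-(‖g c‖ + ‖v‖)) * hsq
        _ ≤ √η * (2 * G) := by
            gcongr
            linarith [hg c]
    have hsum := sum_exp_le_of_sum_eq_zero x hxb hx0
    rw [Fintype.card_fin] at hsum
    calc _ = ∑ c, Real.exp (θ * ∑ s ∈ Finset.range t,
            learningRate t₀ (s + 1) * gradNoise ℓ w₁ t₀ ω s i) * Real.exp (x c) := by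
          refine Finset.sum_congr rfl fun c _ => ?_
          rw [← Real.exp_add, Finset.sum_range_succ, gradNoise_redraw_self, mul_add]
          congr 3
          refine Finset.sum_congr rfl fun s hs => ?_
          rw [gradNoise_redraw_of_lt ℓ w₁ t₀ ω ht c (Finset.mem_range.mp hs)]
      _ ≤ Real.exp (θ * ∑ s ∈ Finset.range t,
            learningRate t₀ (s + 1) * gradNoise ℓ w₁ t₀ ω s i) *
            (m * Real.exp ((|θ| * (√η * (2 * G))) ^ 2 / 2)) := by
          rw [← Finset.mul_sum]; gcongr
      _ = _ := by
          have : (|θ| * (√η * (2 * G))) ^ 2 / 2 = 2 * θ ^ 2 * G ^ 2 * η := by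
            rw [mul_pow, sq_abs, mul_pow, Real.sq_sqrt hη0.le]; ring
          rw [this, Real.exp_add]; ring
  · gcongr
    rw [← Finset.mul_sum, mul_pow, Real.sq_sqrt (by positivity), ← mul_assoc]
    gcongr
    exact sum_learningRate_le ht₀ hT

end Noise

/-! ### The distance travelled by SGD -/

section Distance

theorem half_le_log_two_div {δ : ℝ} (hδ : 0 < δ) (hδ1 : δ < 1) : 1 / 2 ≤ Real.log (2 / δ) := by
  have h1 : Real.log 2 ≤ Real.log (2 / δ) :=
    Real.log_le_log (by norm_num) (by rw [le_div_iff₀ hδ]; linarith)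
  linarith [Real.log_two_gt_d9]

theorem exp_neg_log_two_div {δ : ℝ} (hδ : 0 < δ) : Real.exp (-Real.log (2 / δ)) = δ / 2 := by
  rw [Real.exp_neg, Real.exp_log (by positivity), inv_div]

/-- `∑ η_t ‖∇R_m(w^{(t)})‖²` is at most this constant times `log (2 / δ)`, with high probability. -/
noncomputable def energyConst (α PF G σ₀ b : ℝ) : ℝ :=
  2 * (2 * b + 2 * (energyDrift α PF G σ₀ * rateSum α) + 3 / energyRate PF G σ₀)

/-- Each coordinate of the noise is at most this constant times `√(log T · log (2 / δ))`, with high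
probability. -/
noncomputable def noiseConst (D : ℕ) (G : ℝ) : ℝ := G * √2 * √(8 * (17 + 16 * D))

/-- The distance travelled is at most this constant times `√(log T · log (2 / δ))`, with high
probability. -/
noncomputable def iterateConst (D : ℕ) (α PF G σ₀ b : ℝ) : ℝ :=
  √2 * √(energyConst α PF G σ₀ b) + (D + 1) * noiseConst D G

theorem iterateConst_pos (D : ℕ) {α PF G σ₀ b : ℝ} (hG : 0 < G) :
    0 < iterateConst D α PF G σ₀ b := by
  unfold iterateConst noiseConst
  positivity

variable {m u T : ℕ} [NeZero m]

theorem prob_energy_gt_le {E : Type*} [NormedAddCommGroup E] [InnerProductSpace ℝ E]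
    [CompleteSpace E] {ℓ : Fin (m + u) → E → ℝ} {w₁ : E} {t₀ r α PF G σ₀ b δ : ℝ}
    (hα : 0 < α) (hα1 : α ≤ 1) (hPF : 0 < PF) (hG : 0 < G) (hb : 0 ≤ b) (ht₀ : 1 ≤ t₀)
    (hδ : 0 < δ) (hδ1 : δ < 1) (hℓ : ∀ i, Differentiable ℝ (ℓ i)) (hℓ0 : ∀ i w, 0 ≤ ℓ i w)
    (hℓb : ∀ i, |ℓ i w₁| ≤ b)
    (hH : ∀ i, ∀ w ∈ Metric.closedBall w₁ r, ∀ w' ∈ Metric.closedBall w₁ r,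
      ‖gradient (ℓ i) w - gradient (ℓ i) w'‖ ≤ PF * max (‖w - w'‖ ^ α) ‖w - w'‖)
    (hball : IteratesInBall T ℓ w₁ t₀ r) (hgrad : BoundedScaledGradients T ℓ w₁ t₀ G)
    (hvar : BoundedGradientVariance T ℓ w₁ t₀ σ₀) :
    prob {ω : Outcome m u T | energyConst α PF G σ₀ b * Real.log (2 / δ) <
      ∑ s ∈ Finset.range T, learningRate t₀ (s + 1) *
          ‖trainGrad ℓ ω.split (sgd ℓ w₁ t₀ ω s)‖ ^ 2} ≤ δ / 8 := by
  have hΛ := half_le_log_two_div hδ hδ1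
  have hexp := exp_neg_log_two_div hδ
  have hlam0 : 0 < energyRate PF G σ₀ := energyRate_pos hPF
  have hsum := sum_exp_energy_le (m := m) (u := u) (T := T) hα hα1 hPF hG ht₀ hℓ hH hball hgrad hvar
  have hC : 0 ≤ energyDrift α PF G σ₀ * rateSum α :=
    mul_nonneg (energyDrift_pos hPF).le (rateSum_nonneg α)
  rw [energyConst]
  set lam := energyRate PF G σ₀
  set CS := energyDrift α PF G σ₀ * rateSum α
  set Λ := Real.log (2 / δ)
  refine prob_le_of_sum_le (fun ω => Real.exp (lam *
      (trainErr ℓ ω.split (sgd ℓ w₁ t₀ ω T) - trainErr ℓ ω.split w₁ +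
        (∑ s ∈ Finset.range T, learningRate t₀ (s + 1) *
          ‖trainGrad ℓ ω.split (sgd ℓ w₁ t₀ ω s)‖ ^ 2) / 2)) * Real.exp (-(lam * CS + 3 * Λ)))
    (fun ω => by positivity) (fun ω hω => ?_) ?_
  · have hω' : 2 * (2 * b + 2 * CS + 3 / lam) * Λ < ∑ s ∈ Finset.range T,
        learningRate t₀ (s + 1) * ‖trainGrad ℓ ω.split (sgd ℓ w₁ t₀ ω s)‖ ^ 2 := hω
    have h1 : 0 ≤ trainErr ℓ ω.split (sgd ℓ w₁ t₀ ω T) :=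
      mul_nonneg (by positivity) (Finset.sum_nonneg fun i _ => hℓ0 _ _)
    have h2 : trainErr ℓ ω.split w₁ ≤ b := by
      have := norm_average_le (x := fun i : Fin m => ℓ (ω.split (Fin.castAdd u i)) w₁)
        fun i => hℓb _
      exact (le_abs_self _).trans this
    rw [← Real.exp_add]
    refine Real.one_le_exp ?_
    have h3 : b ≤ 2 * b * Λ := by nlinarith
    have h4 : CS ≤ 2 * CS * Λ := by nlinarith
    have h5 : lam * (3 / lam * Λ) = 3 * Λ := by field_simp
    have h6 : CS + 3 / lam * Λ ≤ trainErr ℓ ω.split (sgd ℓ w₁ t₀ ω T) - trainErr ℓ ω.split w₁ +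
        (∑ s ∈ Finset.range T, learningRate t₀ (s + 1) *
          ‖trainGrad ℓ ω.split (sgd ℓ w₁ t₀ ω s)‖ ^ 2) / 2 := by linarith
    have h7 := mul_le_mul_of_nonneg_left h6 hlam0.le
    linarith
  · rw [← Finset.sum_mul]
    calc _ ≤ (Fintype.card (Outcome m u T) * Real.exp (lam * CS)) *
          Real.exp (-(lam * CS + 3 * Λ)) := by gcongr
      _ = Fintype.card (Outcome m u T) * Real.exp (-Λ) ^ 3 := by
          rw [mul_assoc, ← Real.exp_add, ← Real.exp_nat_mul]
          congr 2
          push_cast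
          ring
      _ ≤ _ := by
          rw [hexp]
          gcongr
          nlinarith [mul_pos hδ hδ, mul_pos (mul_pos hδ hδ) hδ]

variable {ι : Type*} [Fintype ι] {ℓ : Fin (m + u) → EuclideanSpace ℝ ι → ℝ} {D : ℕ}

theorem prob_exists_noise_gt_le (hD : Fintype.card ι ≤ D) {w₁ : EuclideanSpace ℝ ι} {t₀ G δ : ℝ}
    (hG : 0 < G) (ht₀ : 1 ≤ t₀) (hT : 2 ≤ T) (hδ : 0 < δ) (hδ1 : δ < 1)
    (hgrad : BoundedScaledGradients T ℓ w₁ t₀ G) :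
    prob {ω : Outcome m u T | ∃ i, noiseConst D G * √(Real.log T) * √(Real.log (2 / δ)) <
      |∑ s ∈ Finset.range T, learningRate t₀ (s + 1) * gradNoise ℓ w₁ t₀ ω s i|} ≤ δ / 8 := by
  have hΛ := half_le_log_two_div hδ hδ1
  have hexp := exp_neg_log_two_div hδ
  set Λ := Real.log (2 / δ)
  have hT' : (2 : ℝ) ≤ T := by exact_mod_cast hT
  have hlog : 0 < Real.log T := Real.log_pos (by linarith)
  set x := √(8 * (17 + 16 * (D : ℝ))) * √Λ with hx
  have hsq : x ^ 2 / 8 = Λ + 16 * (D + 1) * Λ := by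
    rw [hx, mul_pow, Real.sq_sqrt (by positivity), Real.sq_sqrt (by linarith)]; ring
  have hlev : noiseConst D G * √(Real.log T) * √Λ = G * √(2 * Real.log T) * x := by
    rw [noiseConst, hx, Real.sqrt_mul (by norm_num) (Real.log T)]; ring
  have htail : Real.exp (-(x ^ 2 / 8)) ≤ δ / 2 * (1 / (8 * (D + 1))) := by
    rw [hsq, neg_add, Real.exp_add, hexp]
    gcongr
    rw [Real.exp_neg, one_div]
    gcongr
    have h1 := Real.add_one_le_exp (16 * (D + 1) * Λ)
    have h2 : 16 * ((D : ℝ) + 1) * (1 / 2) ≤ 16 * (D + 1) * Λ := by gcongr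
    linarith
  have hset : {ω : Outcome m u T | ∃ i, noiseConst D G * √(Real.log T) * √Λ <
      |∑ s ∈ Finset.range T, learningRate t₀ (s + 1) * gradNoise ℓ w₁ t₀ ω s i|} ⊆
      ⋃ i ∈ (Finset.univ : Finset ι), {ω : Outcome m u T | G * √(2 * Real.log T) * x <
      |∑ s ∈ Finset.range T, learningRate t₀ (s + 1) * gradNoise ℓ w₁ t₀ ω s i|} := by
    rintro ω ⟨i, hi⟩
    rw [hlev] at hi
    exact Set.mem_biUnion (Finset.mem_univ i) hi
  have hD' : (Fintype.card ι : ℝ) ≤ D := by exact_mod_cast hD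
  calc _ ≤ _ := prob_mono hset
    _ ≤ _ := prob_biUnion_le _ _
    _ ≤ ∑ _i : ι, 2 * Real.exp (-(x ^ 2 / 8)) :=
        Finset.sum_le_sum fun i _ => prob_abs_gt_le _ (by positivity)
          (fun θ => sum_exp_noise_le hG ht₀ hT hgrad i θ) (by positivity)
    _ = Fintype.card ι * (2 * Real.exp (-(x ^ 2 / 8))) := by simp
    _ ≤ D * (2 * (δ / 2 * (1 / (8 * (D + 1))))) := by gcongr
    _ = δ / 8 * (D / (D + 1)) := by field_simp
    _ ≤ δ / 8 * 1 := by
        gcongr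
        exact div_le_one_of_le₀ (by linarith) (by positivity)
    _ = _ := mul_one _

theorem prob_norm_sgd_sub_gt_le (hD : Fintype.card ι ≤ D) {w₁ : EuclideanSpace ℝ ι}
    {t₀ r α PF G σ₀ b δ : ℝ}
    (hα : 0 < α) (hα1 : α ≤ 1) (hPF : 0 < PF) (hG : 0 < G) (hb : 0 ≤ b) (ht₀ : 1 ≤ t₀)
    (hT : 2 ≤ T) (hδ : 0 < δ) (hδ1 : δ < 1) (hℓ : ∀ i, Differentiable ℝ (ℓ i))
    (hℓ0 : ∀ i w, 0 ≤ ℓ i w) (hℓb : ∀ i, |ℓ i w₁| ≤ b)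
    (hH : ∀ i, ∀ w ∈ Metric.closedBall w₁ r, ∀ w' ∈ Metric.closedBall w₁ r,
      ‖gradient (ℓ i) w - gradient (ℓ i) w'‖ ≤ PF * max (‖w - w'‖ ^ α) ‖w - w'‖)
    (hball : IteratesInBall T ℓ w₁ t₀ r) (hgrad : BoundedScaledGradients T ℓ w₁ t₀ G)
    (hvar : BoundedGradientVariance T ℓ w₁ t₀ σ₀) :
    prob {ω : Outcome m u T | iterateConst D α PF G σ₀ b * √(Real.log T) * √(Real.log (2 / δ)) <
      ‖sgd ℓ w₁ t₀ ω T - w₁‖} ≤ δ / 4 := by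
  have h1 := prob_energy_gt_le (m := m) (u := u) (T := T) hα hα1 hPF hG hb ht₀ hδ hδ1 hℓ hℓ0 hℓb
    hH hball hgrad hvar
  have h2 := prob_exists_noise_gt_le (m := m) (u := u) (T := T) hD hG ht₀ hT hδ hδ1 hgrad
  set Λ := Real.log (2 / δ) with hΛdef
  have hΛ : 1 / 2 ≤ Λ := half_le_log_two_div hδ hδ1
  have hlog : 0 ≤ Real.log T := Real.log_natCast_nonneg T
  refine le_trans (prob_mono fun ω hω => ?_) ((prob_union_le _ _).trans
    ((add_le_add h1 h2).trans_eq (by ring)))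
  by_contra hnot
  rw [Set.mem_union, not_or] at hnot
  obtain ⟨hE, hN⟩ := hnot
  simp only [Set.mem_ofPred_eq, not_lt, not_exists] at hE hN hω
  refine absurd hω (not_lt.mpr ?_)
  rw [sgd_sub_eq]
  have hη : ∀ s, 0 < learningRate t₀ (s + 1) := fun s => learningRate_pos ht₀ _
  have hdrift : ‖∑ s ∈ Finset.range T, learningRate t₀ (s + 1) •
      trainGrad ℓ ω.split (sgd ℓ w₁ t₀ ω s)‖ ≤
      √2 * √(energyConst α PF G σ₀ b) * √(Real.log T) * √Λ := by
    have h3 : ‖∑ s ∈ Finset.range T, learningRate t₀ (s + 1) •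
        trainGrad ℓ ω.split (sgd ℓ w₁ t₀ ω s)‖ ≤ ∑ s ∈ Finset.range T,
        √(learningRate t₀ (s + 1)) *
          (√(learningRate t₀ (s + 1)) * ‖trainGrad ℓ ω.split (sgd ℓ w₁ t₀ ω s)‖) := by
      refine (norm_sum_le _ _).trans (Finset.sum_le_sum fun s _ => ?_)
      rw [norm_smul, Real.norm_of_nonneg (hη s).le, ← mul_assoc, Real.mul_self_sqrt (hη s).le]
    -- the Cauchy–Schwarz inequality
    have h4 := Finset.sum_mul_sq_le_sq_mul_sq (Finset.range T)
      (fun s => √(learningRate t₀ (s + 1)))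
      (fun s => √(learningRate t₀ (s + 1)) * ‖trainGrad ℓ ω.split (sgd ℓ w₁ t₀ ω s)‖)
    simp only [mul_pow, Real.sq_sqrt (hη _).le] at h4
    have h5 : (∑ s ∈ Finset.range T, √(learningRate t₀ (s + 1)) *
        (√(learningRate t₀ (s + 1)) * ‖trainGrad ℓ ω.split (sgd ℓ w₁ t₀ ω s)‖)) ^ 2 ≤
        2 * Real.log T * (energyConst α PF G σ₀ b * Λ) := by
      refine h4.trans ?_
      have h6 := sum_learningRate_le ht₀ hT
      have h7 : 0 ≤ ∑ s ∈ Finset.range T, learningRate t₀ (s + 1) *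
          ‖trainGrad ℓ ω.split (sgd ℓ w₁ t₀ ω s)‖ ^ 2 :=
        Finset.sum_nonneg fun s _ => mul_nonneg (hη s).le (sq_nonneg _)
      gcongr
    refine h3.trans ((Real.le_sqrt_of_sq_le h5).trans_eq ?_)
    have hec : 0 ≤ energyConst α PF G σ₀ b := by
      have h8 := energyRate_pos (G := G) (σ₀ := σ₀) hPF
      have h9 := energyDrift_pos (α := α) (G := G) (σ₀ := σ₀) hPF
      have h10 := rateSum_nonneg α
      unfold energyConst
      positivity
    rw [Real.sqrt_mul (by positivity), Real.sqrt_mul (by norm_num), Real.sqrt_mul hec]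
    ring
  have hnoise : ‖∑ s ∈ Finset.range T, learningRate t₀ (s + 1) • gradNoise ℓ w₁ t₀ ω s‖ ≤
      (D + 1) * (noiseConst D G * √(Real.log T) * √Λ) := by
    refine norm_le_of_forall_coord_le hD _ (by unfold noiseConst; positivity) fun i => ?_
    have := hN i
    simpa using this
  refine (norm_sub_le _ _).trans ?_
  rw [norm_neg]
  refine (add_le_add hdrift hnoise).trans_eq ?_
  rw [iterateConst]
  ring

end Distance

/-! ### Hölder smoothness of graph neural networks -/

section Holder

variable {E F V : Type*} [NormedAddCommGroup E] [NormedAddCommGroup F] [NormedAddCommGroup V]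
  {α : ℝ} {S : Set E}

/-- `g` is bounded and `α`-Hölder on `S`. -/
def BddHolderOn (α : ℝ) (S : Set E) (g : E → F) : Prop :=
  ∃ K, 0 ≤ K ∧ (∀ w ∈ S, ‖g w‖ ≤ K) ∧ ∀ w ∈ S, ∀ w' ∈ S, ‖g w - g w'‖ ≤ K * ‖w - w'‖ ^ α

theorem BddHolderOn.of_bounds {g : E → F} {K₁ K₂ : ℝ} (h1 : ∀ w ∈ S, ‖g w‖ ≤ K₁)
    (h2 : ∀ w ∈ S, ∀ w' ∈ S, ‖g w - g w'‖ ≤ K₂ * ‖w - w'‖ ^ α) : BddHolderOn α S g := by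
  refine ⟨max 0 (max K₁ K₂), le_max_left _ _,
    fun w hw => (h1 w hw).trans ((le_max_left _ _).trans (le_max_right _ _)),
    fun w hw w' hw' => (h2 w hw w' hw').trans ?_⟩
  gcongr
  exact (le_max_right _ _).trans (le_max_right _ _)

/-- On a bounded set, Lipschitz bounds are `α`-Hölder bounds. -/
theorem exists_norm_sub_le_rpow (hα1 : α ≤ 1) (hSb : Bornology.IsBounded S) :
    ∃ c, 0 ≤ c ∧ ∀ w ∈ S, ∀ w' ∈ S, ‖w - w'‖ ≤ c * ‖w - w'‖ ^ α := by
  refine ⟨Metric.diam S ^ (1 - α), by positivity, fun w hw w' hw' => ?_⟩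
  rcases (norm_nonneg (w - w')).eq_or_lt with h0 | h0
  · rw [← h0]; positivity
  · have h1 : ‖w - w'‖ ≤ Metric.diam S := by
      rw [← dist_eq_norm]; exact Metric.dist_le_diam_of_mem hSb hw hw'
    calc ‖w - w'‖ = ‖w - w'‖ ^ (1 - α) * ‖w - w'‖ ^ α := by
          rw [← Real.rpow_add h0]; simp
      _ ≤ _ := by
          gcongr


theorem BddHolderOn.const (c : F) : BddHolderOn α S fun _ => c :=
  BddHolderOn.of_bounds (K₁ := ‖c‖) (K₂ := 0) (fun _ _ => le_rfl) fun _ _ _ _ => by simp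

theorem BddHolderOn.add {f g : E → F} (hf : BddHolderOn α S f) (hg : BddHolderOn α S g) :
    BddHolderOn α S fun w => f w + g w := by
  obtain ⟨K, _, h1, h2⟩ := hf
  obtain ⟨K', _, h1', h2'⟩ := hg
  refine BddHolderOn.of_bounds (K₁ := K + K') (K₂ := K + K')
    (fun w hw => norm_add_le_of_le (h1 w hw) (h1' w hw)) fun w hw w' hw' => ?_
  rw [add_sub_add_comm, add_mul]
  exact norm_add_le_of_le (h2 w hw w' hw') (h2' w hw w' hw')

variable [NormedSpace ℝ F] [NormedSpace ℝ V]

/-- Continuous bilinear maps preserve the class. -/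
theorem BddHolderOn.bilin {G : Type*} [NormedAddCommGroup G] [NormedSpace ℝ G]
    (B : F →L[ℝ] V →L[ℝ] G) {f : E → F} {g : E → V} (hf : BddHolderOn α S f)
    (hg : BddHolderOn α S g) : BddHolderOn α S fun w => B (f w) (g w) := by
  obtain ⟨K, hK, h1, h2⟩ := hf
  obtain ⟨K', hK', h1', h2'⟩ := hg
  refine BddHolderOn.of_bounds (K₁ := ‖B‖ * K * K') (K₂ := ‖B‖ * K * K' + ‖B‖ * K * K')
    (fun w hw => (B.le_opNorm₂ _ _).trans (by gcongr; exacts [h1 w hw, h1' w hw]))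
    fun w hw w' hw' => ?_
  have he : B (f w) (g w) - B (f w') (g w') = B (f w) (g w - g w') + B (f w - f w') (g w') := by
    simp
  rw [he]
  calc _ ≤ ‖B‖ * ‖f w‖ * ‖g w - g w'‖ + ‖B‖ * ‖f w - f w'‖ * ‖g w'‖ :=
        norm_add_le_of_le (B.le_opNorm₂ _ _) (B.le_opNorm₂ _ _)
    _ ≤ ‖B‖ * K * (K' * ‖w - w'‖ ^ α) + ‖B‖ * (K * ‖w - w'‖ ^ α) * K' := by
        gcongr
        exacts [h1 w hw, h2' w hw w' hw', h2 w hw w' hw', h1' w' hw']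
    _ = _ := by ring

variable [NormedSpace ℝ E]

/-- `f` is differentiable, and on `S` its derivative is bounded and `α`-Hölder. -/
def IsHolderC1 (α : ℝ) (S : Set E) (f : E → F) : Prop :=
  Differentiable ℝ f ∧ BddHolderOn α S (fderiv ℝ f)

theorem IsHolderC1.const (c : F) : IsHolderC1 α S fun _ : E => c := by
  refine ⟨differentiable_const c, ?_⟩
  rw [fderiv_fun_const]
  exact BddHolderOn.const 0

theorem IsHolderC1.clm (L : E →L[ℝ] F) : IsHolderC1 α S fun w => L w := by
  refine ⟨L.differentiable, ?_⟩
  have : fderiv ℝ (fun w => L w) = fun _ => L := funext fun w => L.fderiv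
  rw [this]
  exact BddHolderOn.const L

theorem IsHolderC1.add {f g : E → F} (hf : IsHolderC1 α S f) (hg : IsHolderC1 α S g) :
    IsHolderC1 α S fun w => f w + g w := by
  refine ⟨hf.1.add hg.1, ?_⟩
  have : fderiv ℝ (fun w => f w + g w) = fun w => fderiv ℝ f w + fderiv ℝ g w :=
    funext fun w => fderiv_fun_add (hf.1 w) (hg.1 w)
  rw [this]
  exact hf.2.add hg.2

theorem IsHolderC1.sum {ι : Type*} (s : Finset ι) {f : ι → E → F}
    (hf : ∀ i, IsHolderC1 α S (f i)) : IsHolderC1 α S fun w => ∑ i ∈ s, f i w := by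
  classical
  induction s using Finset.induction_on with
  | empty => simpa using IsHolderC1.const (0 : F)
  | insert i s hi ih =>
    simp only [Finset.sum_insert hi]
    exact (hf i).add ih

theorem IsHolderC1.clm_comp (L : F →L[ℝ] V) {f : E → F} (hf : IsHolderC1 α S f) :
    IsHolderC1 α S fun w => L (f w) := by
  refine ⟨L.differentiable.comp hf.1, ?_⟩
  have : fderiv ℝ (fun w => L (f w)) =
      fun w => ContinuousLinearMap.compL ℝ E F V L (fderiv ℝ f w) :=
    funext fun w => (L.hasFDerivAt.comp w (hf.1 w).hasFDerivAt).fderiv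
  rw [this]
  exact (BddHolderOn.const L).bilin _ hf.2

variable (hα : 0 ≤ α) (hα1 : α ≤ 1) (hS : Convex ℝ S) (hSb : Bornology.IsBounded S)

include hS in
theorem IsHolderC1.exists_lipschitz {f : E → F} (hf : IsHolderC1 α S f) :
    ∃ M, 0 ≤ M ∧ ∀ w ∈ S, ∀ w' ∈ S, ‖f w - f w'‖ ≤ M * ‖w - w'‖ := by
  obtain ⟨hd, K, hK, h1, _⟩ := hf
  exact ⟨K, hK, fun w hw w' hw' =>
    hS.norm_image_sub_le_of_norm_fderiv_le (fun x _ => hd x) h1 hw' hw⟩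

include hα1 hS hSb in
theorem IsHolderC1.bddHolderOn {f : E → F} (hf : IsHolderC1 α S f) : BddHolderOn α S f := by
  obtain ⟨M, hM, h⟩ := hf.exists_lipschitz hS
  obtain ⟨c, hc, hc'⟩ := exists_norm_sub_le_rpow hα1 hSb
  rcases S.eq_empty_or_nonempty with rfl | ⟨w₀, hw₀⟩
  · exact ⟨0, le_rfl, by simp, by simp⟩
  refine BddHolderOn.of_bounds (K₁ := M * Metric.diam S + ‖f w₀‖) (K₂ := M * c)
    (fun w hw => ?_) fun w hw w' hw' => (h w hw w' hw').trans ?_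
  · have h1 : ‖w - w₀‖ ≤ Metric.diam S := by
      rw [← dist_eq_norm]; exact Metric.dist_le_diam_of_mem hSb hw hw₀
    calc ‖f w‖ ≤ ‖f w - f w₀‖ + ‖f w₀‖ := by simpa using norm_add_le (f w - f w₀) (f w₀)
      _ ≤ _ := by gcongr; exact (h w hw w₀ hw₀).trans (by gcongr)
  · rw [mul_assoc]; gcongr; exact hc' w hw w' hw'

include hα1 hS hSb in
theorem IsHolderC1.mul {f g : E → ℝ} (hf : IsHolderC1 α S f) (hg : IsHolderC1 α S g) :
    IsHolderC1 α S fun w => f w * g w := by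
  refine ⟨hf.1.mul hg.1, ?_⟩
  have : fderiv ℝ (fun w => f w * g w) = fun w => ContinuousLinearMap.lsmul ℝ ℝ (f w) (fderiv ℝ g w)
      + ContinuousLinearMap.lsmul ℝ ℝ (g w) (fderiv ℝ f w) :=
    funext fun w => fderiv_fun_mul (hf.1 w) (hg.1 w)
  rw [this]
  exact ((hf.bddHolderOn hα1 hS hSb).bilin _ hg.2).add ((hg.bddHolderOn hα1 hS hSb).bilin _ hf.2)

include hα hα1 hS hSb in
/-- Composition with an activation whose derivative is `α`-Hölder. The inner function is Lipschitz, not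
only `α`-Hölder, so the exponent is kept. -/
theorem IsHolderC1.activation {act : ℝ → ℝ} {P : ℝ} (hP : 0 ≤ P) (hact : Differentiable ℝ act)
    (hH : ∀ s t : ℝ, |deriv act s - deriv act t| ≤ P * |s - t| ^ α) {f : E → ℝ}
    (hf : IsHolderC1 α S f) : IsHolderC1 α S fun w => act (f w) := by
  refine ⟨hact.comp hf.1, ?_⟩
  have : fderiv ℝ (fun w => act (f w)) =
      fun w => ContinuousLinearMap.lsmul ℝ ℝ (deriv act (f w)) (fderiv ℝ f w) :=
    funext fun w => ((hact (f w)).hasDerivAt.comp_hasFDerivAt w (hf.1 w).hasFDerivAt).fderiv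
  rw [this]
  refine BddHolderOn.bilin _ ?_ hf.2
  obtain ⟨M, hM, h⟩ := hf.exists_lipschitz hS
  obtain ⟨K, hK, hb, _⟩ := hf.bddHolderOn hα1 hS hSb
  refine BddHolderOn.of_bounds (K₁ := P * K ^ α + |deriv act 0|) (K₂ := P * M ^ α)
    (fun w hw => ?_) fun w hw w' hw' => ?_
  · have h1 := hH (f w) 0
    rw [sub_zero] at h1
    calc |deriv act (f w)| ≤ |deriv act (f w) - deriv act 0| + |deriv act 0| := by
          simpa using abs_add_le (deriv act (f w) - deriv act 0) (deriv act 0)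
      _ ≤ _ := by
          gcongr
          refine h1.trans ?_
          gcongr
          exact hb w hw
  · refine (hH _ _).trans ?_
    rw [mul_assoc, ← Real.mul_rpow hM (norm_nonneg _)]
    gcongr
    exact h w hw w' hw'

include hα1 hS hSb in
/-- Composition with a `C²` function on a finite-dimensional space. -/
theorem IsHolderC1.comp_contDiff [FiniteDimensional ℝ F] {φ : F → V} (hφ : ContDiff ℝ 2 φ)
    {f : E → F} (hf : IsHolderC1 α S f) : IsHolderC1 α S fun w => φ (f w) := by
  have hφd : Differentiable ℝ φ := hφ.differentiable (by norm_num)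
  refine ⟨hφd.comp hf.1, ?_⟩
  have : fderiv ℝ (fun w => φ (f w)) =
      fun w => ContinuousLinearMap.compL ℝ E F V (fderiv ℝ φ (f w)) (fderiv ℝ f w) :=
    funext fun w => ((hφd (f w)).hasFDerivAt.comp w (hf.1 w).hasFDerivAt).fderiv
  rw [this]
  refine BddHolderOn.bilin _ ?_ hf.2
  obtain ⟨K, hK, hb, hH⟩ := hf.bddHolderOn hα1 hS hSb
  have hφ1 : ContDiff ℝ 1 (fderiv ℝ φ) := hφ.fderiv_right (by norm_num)
  have hcomp : IsCompact (Metric.closedBall (0 : F) K) := isCompact_closedBall 0 K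
  obtain ⟨C₀, hC₀⟩ := hcomp.exists_bound_of_continuousOn hφ1.continuous.continuousOn
  obtain ⟨C₁, hC₁⟩ := hcomp.exists_bound_of_continuousOn
    (hφ1.continuous_fderiv (by norm_num)).continuousOn
  have hmem : ∀ w ∈ S, f w ∈ Metric.closedBall (0 : F) K := fun w hw => by
    simpa using hb w hw
  refine BddHolderOn.of_bounds (K₁ := C₀) (K₂ := max C₁ 0 * K) (fun w hw => hC₀ _ (hmem w hw))
    fun w hw w' hw' => ?_
  calc _ ≤ max C₁ 0 * ‖f w - f w'‖ :=
        (convex_closedBall (0 : F) K).norm_image_sub_le_of_norm_fderiv_le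
          (fun x _ => hφ1.differentiable (by norm_num) x)
          (fun x hx => (hC₁ x hx).trans (le_max_left _ _)) (hmem w' hw') (hmem w hw)
    _ ≤ _ := by rw [mul_assoc]; gcongr; exact hH w hw w' hw'

end Holder

section Network

variable {n d₀ k H : ℕ} {p q : Fin H → ℕ} {α P : ℝ} {S : Set (Params p q)}

theorem GNN.isHolderC1_eval (hα : 0 ≤ α) (hα1 : α ≤ 1) (hS : Convex ℝ S)
    (hSb : Bornology.IsBounded S) {act : ℝ → ℝ} (hP : 0 ≤ P) (hact : Differentiable ℝ act)
    (hH : ∀ s t : ℝ, |deriv act s - deriv act t| ≤ P * |s - t| ^ α)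
    (A : Matrix (Fin n) (Fin n) ℝ) (X : Matrix (Fin n) (Fin d₀) ℝ) {k : ℕ} (net : GNN d₀ p q k) :
    ∀ i j, IsHolderC1 α S fun w => net.eval act A X w i j := by
  have hcoord : ∀ x : ParamIdx p q, IsHolderC1 α S fun w : Params p q => w x := fun x =>
    IsHolderC1.clm (EuclideanSpace.proj x : Params p q →L[ℝ] ℝ)
  induction net with
  | input => exact fun i j => IsHolderC1.const _
  | weight h Z ih =>
    intro i j
    simp only [GNN.eval, Matrix.mul_apply, weightMatrix, Matrix.of_apply]
    exact IsHolderC1.sum _ fun a => (ih i a).mul hα1 hS hSb (hcoord _)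
  | filter g Z ih =>
    intro i j
    simp only [GNN.eval, Matrix.mul_apply]
    exact IsHolderC1.sum _ fun a => (IsHolderC1.const _).mul hα1 hS hSb (ih a j)
  | learnedFilter h c Z ih =>
    intro i j
    simp only [GNN.eval, Matrix.mul_apply, Matrix.sum_apply, Matrix.smul_apply, smul_eq_mul,
      weightMatrix, Matrix.of_apply]
    exact IsHolderC1.sum _ fun a => (IsHolderC1.sum _ fun b =>
      (hcoord _).mul hα1 hS hSb (IsHolderC1.const _)).mul hα1 hS hSb (ih a j)
  | act Z ih =>
    intro i j
    simp only [GNN.eval, Matrix.map_apply]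
    exact (ih i j).activation hα hα1 hS hSb hP hact hH
  | add Z Z' ih ih' =>
    intro i j
    simp only [GNN.eval, Matrix.add_apply]
    exact (ih i j).add (ih' i j)
  | smul a Z ih =>
    intro i j
    simp only [GNN.eval, Matrix.smul_apply, smul_eq_mul]
    exact (IsHolderC1.const a).mul hα1 hS hSb (ih i j)

theorem isHolderC1_nodeLoss (hα : 0 ≤ α) (hα1 : α ≤ 1) (hS : Convex ℝ S)
    (hSb : Bornology.IsBounded S) {act : ℝ → ℝ} (hP : 0 ≤ P) (hact : Differentiable ℝ act)
    (hH : ∀ s t : ℝ, |deriv act s - deriv act t| ≤ P * |s - t| ^ α) {𝒴 : Type*}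
    (net : GNN d₀ p q k) (φ : PredictionLoss 𝒴 k) (Γ : SimpleGraph (Fin n))
    (X : Matrix (Fin n) (Fin d₀) ℝ) (y : Fin n → 𝒴) (i : Fin n) :
    IsHolderC1 α S (nodeLoss net act φ Γ X y i) := by
  refine IsHolderC1.comp_contDiff hα1 hS hSb (φ.contDiff (y i))
    (f := fun w => net.eval act (normAdj Γ) X w i) ?_
  have : (fun w => net.eval act (normAdj Γ) X w i) = fun w => ∑ j,
      ContinuousLinearMap.single ℝ (fun _ : Fin k => ℝ) j (net.eval act (normAdj Γ) X w i j) := by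
    funext w
    exact (Finset.univ_sum_single _).symm
  rw [this]
  exact IsHolderC1.sum _ fun j => IsHolderC1.clm_comp _
    (net.isHolderC1_eval hα hα1 hS hSb hP hact hH _ X i j)

end Network

section Constants

variable {E : Type*} [NormedAddCommGroup E] {n : ℕ} {ℓ : Fin n → E → ℝ} {w₁ : E} {r α : ℝ}

theorem le_sInf_mul {s : Set ℝ} (hs : s.Nonempty) {a x : ℝ} (hx : 0 ≤ x)
    (h : ∀ P ∈ s, a ≤ P * x) : a ≤ sInf s * x := by
  rcases hx.eq_or_lt with rfl | hx
  · obtain ⟨P, hP⟩ := hs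
    simpa using h P hP
  · rw [← div_le_iff₀ hx]
    exact le_csInf hs fun P hP => (div_le_iff₀ hx).mpr (h P hP)

theorem abs_sub_le_lipschitzConst (hL : 0 < lipschitzConst ℓ w₁ r) (i : Fin n) {w w' : E}
    (hw : w ∈ Metric.closedBall w₁ r) (hw' : w' ∈ Metric.closedBall w₁ r) :
    |ℓ i w - ℓ i w'| ≤ lipschitzConst ℓ w₁ r * ‖w - w'‖ := by
  refine le_sInf_mul ?_ (norm_nonneg _) fun L hL => hL.2 i w hw w' hw'
  -- the infimum of the empty set is `0`
  by_contra hne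
  rw [lipschitzConst, Set.not_nonempty_iff_eq_empty.mp hne, Real.sInf_empty] at hL
  exact lt_irrefl _ hL

variable [InnerProductSpace ℝ E] [CompleteSpace E]

theorem norm_gradient_sub_le_holderConst
    (hℓ : ∀ i, IsHolderC1 α (Metric.closedBall w₁ r) (ℓ i)) (i : Fin n) {w w' : E}
    (hw : w ∈ Metric.closedBall w₁ r) (hw' : w' ∈ Metric.closedBall w₁ r) :
    ‖gradient (ℓ i) w - gradient (ℓ i) w'‖ ≤
      holderConst ℓ α w₁ r * max (‖w - w'‖ ^ α) ‖w - w'‖ := by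
  refine le_sInf_mul ?_ (le_max_of_le_right (norm_nonneg _)) fun P hP => hP.2 i w hw w' hw'
  choose K hK0 _ hK using fun i => (hℓ i).2
  refine ⟨∑ i, K i, Finset.sum_nonneg fun i _ => hK0 i, fun i w hw w' hw' => ?_⟩
  rw [gradient, gradient, ← map_sub, LinearIsometryEquiv.norm_map]
  refine (hK i w hw w' hw').trans ?_
  have h1 : K i ≤ ∑ i, K i := Finset.single_le_sum (fun i _ => hK0 i) (Finset.mem_univ i)
  have h2 : 0 ≤ ∑ i, K i := (hK0 i).trans h1
  gcongr
  exact le_max_left _ _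

end Constants

/-! ### The generalization bound -/

/-- The constant of the generalization bound. -/
noncomputable def gapConst (D : ℕ) (α PF G σ₀ b L₀ : ℝ) : ℝ :=
  24 * b / L₀ + chainConst D * iterateConst D α PF G σ₀ b

theorem chainConst_pos (D : ℕ) : 0 < chainConst D := by unfold chainConst; positivity

theorem gapConst_pos (D : ℕ) {α PF G σ₀ b L₀ : ℝ} (hG : 0 < G) (hb : 0 < b) (hL₀ : 0 < L₀) :
    0 < gapConst D α PF G σ₀ b L₀ := by
  have h1 := chainConst_pos D
  have h2 := iterateConst_pos D (α := α) (PF := PF) (σ₀ := σ₀) (b := b) hG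
  unfold gapConst
  positivity

theorem half_le_sqrt {x : ℝ} (hx : 1 / 2 ≤ x) : 1 / 2 ≤ √x :=
  Real.le_sqrt_of_sq_le (by linarith)

/-- The generalization bound for arbitrary losses with the smoothness properties of a network: the gap
at the last iterate is at most the gap at `w₁` plus the uniform deviation over a ball which contains
the last iterate with high probability. -/
theorem prob_genGap_le {m u T : ℕ} [NeZero m] [NeZero u] {ι : Type*} [Fintype ι]
    {ℓ : Fin (m + u) → EuclideanSpace ℝ ι → ℝ} {D : ℕ}
    (hD : Fintype.card ι ≤ D) {w₁ : EuclideanSpace ℝ ι} {t₀ r α PF G σ₀ b L L₀ δ : ℝ}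
    (hα : 0 < α) (hα1 : α ≤ 1) (hPF : 0 < PF) (hG : 0 < G) (hb : 0 ≤ b) (hr : 0 ≤ r)
    (hL₀ : 0 < L₀) (hL : L₀ ≤ L) (ht₀ : 1 ≤ t₀)
    (hT : 2 ≤ T) (hδ : 0 < δ) (hδ1 : δ < 1) (hℓ : ∀ i, Differentiable ℝ (ℓ i))
    (hℓ0 : ∀ i w, 0 ≤ ℓ i w) (hℓb : ∀ i, |ℓ i w₁| ≤ b)
    (hLip : ∀ i, ∀ w ∈ Metric.closedBall w₁ r, ∀ w' ∈ Metric.closedBall w₁ r,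
      |ℓ i w - ℓ i w'| ≤ L * ‖w - w'‖)
    (hH : ∀ i, ∀ w ∈ Metric.closedBall w₁ r, ∀ w' ∈ Metric.closedBall w₁ r,
      ‖gradient (ℓ i) w - gradient (ℓ i) w'‖ ≤ PF * max (‖w - w'‖ ^ α) ‖w - w'‖)
    (hball : IteratesInBall T ℓ w₁ t₀ r) (hgrad : BoundedScaledGradients T ℓ w₁ t₀ G)
    (hvar : BoundedGradientVariance T ℓ w₁ t₀ σ₀) :
    1 - δ ≤ prob {ω : Outcome m u T | genGap ℓ w₁ t₀ ω ≤
      gapConst D α PF G σ₀ b L₀ *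
        (L * sizeFactor m u * √(Real.log T) * Real.log (2 / δ))} := by
  have hΦ : 0 < sizeFactor m u := sizeFactor_pos
  have hC1 := chainConst_pos D
  have hC2 := iterateConst_pos D (α := α) (PF := PF) (σ₀ := σ₀) (b := b) hG
  have hiter := prob_norm_sgd_sub_gt_le (m := m) (u := u) hD hα hα1 hPF hG hb ht₀ hT hδ hδ1 hℓ hℓ0
    hℓb hH hball hgrad hvar
  have hΛ := half_le_log_two_div hδ hδ1
  have hsΛ := half_le_sqrt hΛ
  have hexp := exp_neg_log_two_div hδ
  have hlogT : 1 / 2 ≤ Real.log T := by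
    have h1 : Real.log 2 ≤ Real.log T := Real.log_le_log (by norm_num) (by exact_mod_cast hT)
    linarith [Real.log_two_gt_d9]
  have hsT := half_le_sqrt hlogT
  have hL0 : 0 < L := hL₀.trans_le hL
  have hR : 0 < iterateConst D α PF G σ₀ b * √(Real.log T) * √(Real.log (2 / δ)) := by positivity
  have hw₁ : w₁ ∈ Metric.closedBall w₁ r ∩ Metric.closedBall w₁
      (iterateConst D α PF G σ₀ b * √(Real.log T) * √(Real.log (2 / δ))) :=
    ⟨Metric.mem_closedBall_self hr, Metric.mem_closedBall_self hR.le⟩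
  have hchain := prob_exists_gap_gt_le (m := m) (u := u) (T := T) hD ℓ _ w₁ hw₁ hR hL0.le
    (fun w hw => mem_closedBall_iff_norm.mp hw.2)
    (fun i w hw w' hw' => hLip i w hw.1 w' hw'.1) hδ hδ1
  have hinit := prob_splitGap_gt_le (m := m) (u := u) (T := T) (fun i => ℓ i w₁)
    (x := √32 * √(Real.log (2 / δ))) hℓb hb (by positivity)
  set Λ := Real.log (2 / δ)
  set R := iterateConst D α PF G σ₀ b * √(Real.log T) * √Λ with hRdef
  set Φ := sizeFactor m u
  have hinit' : 2 * Real.exp (-((√32 * √Λ) ^ 2 / 8)) ≤ δ / 4 := by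
    have h1 : -((√32 * √Λ) ^ 2 / 8) = (4 : ℕ) * -Λ := by
      rw [mul_pow, Real.sq_sqrt (by norm_num), Real.sq_sqrt (by linarith)]
      push_cast
      ring
    rw [h1, Real.exp_nat_mul, hexp]
    have h2 : δ ^ 4 ≤ δ := by simpa using pow_le_pow_of_le_one hδ.le hδ1.le (by norm_num : 1 ≤ 4)
    linarith [h2]
  have hcompl : prob {ω : Outcome m u T | genGap ℓ w₁ t₀ ω ≤
      gapConst D α PF G σ₀ b L₀ * (L * Φ * √(Real.log T) * Λ)}ᶜ ≤ δ := by
    refine (prob_mono fun ω hω => ?_).trans ((prob_union_le _ _).trans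
      ((add_le_add ((prob_union_le _ _).trans (add_le_add (hinit.trans hinit') hchain)) hiter).trans
        (by linarith)))
    by_contra hnot
    rw [Set.mem_union, Set.mem_union, not_or, not_or] at hnot
    obtain ⟨⟨h1, h2⟩, h3⟩ := hnot
    simp only [Set.mem_ofPred_eq, not_lt, not_exists, not_and] at h1 h2 h3
    refine hω ?_
    have h4 := h2 (sgd ℓ w₁ t₀ ω T)
      ⟨hball ω T le_rfl, mem_closedBall_iff_norm.mpr h3⟩
    have h5 : genGap ℓ w₁ t₀ ω = |splitGap (fun i => ℓ i (sgd ℓ w₁ t₀ ω T)) ω.split| := rfl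
    have h6 := abs_add_le (splitGap (fun i => ℓ i (sgd ℓ w₁ t₀ ω T)) ω.split -
      splitGap (fun i => ℓ i w₁) ω.split) (splitGap (fun i => ℓ i w₁) ω.split)
    rw [sub_add_cancel, ← h5] at h6
    have h7 : chainConst D * (L * R * Φ * √Λ) =
        chainConst D * iterateConst D α PF G σ₀ b * (L * Φ * √(Real.log T) * Λ) := by
      rw [hRdef]
      have : √Λ * √Λ = Λ := Real.mul_self_sqrt (by linarith)
      linear_combination (chainConst D * (L * iterateConst D α PF G σ₀ b * √(Real.log T) * Φ)) * this
    have h8 : b * Φ * (√32 * √Λ) ≤ 24 * b / L₀ * (L * Φ * √(Real.log T) * Λ) := by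
      have h9 : √32 ≤ 6 := Real.sqrt_le_iff.mpr ⟨by norm_num, by norm_num⟩
      have h10 : √Λ ≤ 2 * Λ := by
        calc √Λ = 1 * √Λ := (one_mul _).symm
          _ ≤ (2 * √Λ) * √Λ := by gcongr; linarith
          _ = 2 * Λ := by rw [mul_assoc, Real.mul_self_sqrt (by linarith)]
      have h11 : 1 ≤ L / L₀ := (one_le_div hL₀).mpr hL
      calc b * Φ * (√32 * √Λ) ≤ b * Φ * (6 * (2 * Λ)) := by gcongr
        _ = 12 * b * Φ * Λ * 1 * 1 := by ring
        _ ≤ 12 * b * Φ * Λ * (L / L₀) * (2 * √(Real.log T)) := by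
            gcongr
            linarith
        _ = _ := by field_simp; ring
    show genGap ℓ w₁ t₀ ω ≤ _
    rw [gapConst, add_mul]
    linarith
  rw [prob_compl] at hcompl
  linarith

end TransductiveGNN

open TransductiveGNN in
theorem theorem1 (D : ℕ) (α PF G σ₀ b L₀ : ℝ) (hα : 0 < α) (hα1 : α ≤ 1) (hPF : 0 < PF)
    (hG : 0 < G) (hσ₀ : 0 < σ₀) (hb : 0 < b) (hL₀ : 0 < L₀) :
    ∃ C : ℝ, 0 < C ∧
      ∀ (𝒴 : Type*) (H d₀ k : ℕ) (p q : Fin H → ℕ) (net : GNN d₀ p q k) (act : ℝ → ℝ)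
        (φ : PredictionLoss 𝒴 k) (m u : ℕ) [NeZero m] [NeZero u]
        (Γ : SimpleGraph (Fin (m + u))) (X : Matrix (Fin (m + u)) (Fin d₀) ℝ)
        (y : Fin (m + u) → 𝒴) (w₁ : Params p q) (r cX cW P t₀ δ : ℝ) (T : ℕ),
        ∑ h, p h * q h ≤ D →
        1 ≤ r →
        -- bounded features
        0 < cX → (∀ i, ‖WithLp.toLp 2 (X i)‖ ≤ cX) →
        -- bounded weights
        0 < cW → (∀ w ∈ Metric.closedBall w₁ r, ∀ h, spectralNorm (weightMatrix w h) ≤ cW) →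
        IteratesInBall T (nodeLoss net act φ Γ X y) w₁ t₀ r →
        -- Hölder-smooth activation
        0 < P → Differentiable ℝ act →
        (∀ s t : ℝ, |deriv act s - deriv act t| ≤ P * |s - t| ^ α) →
        -- bounded product of gradient and root of the learning rate, bounded variance
        BoundedScaledGradients T (nodeLoss net act φ Γ X y) w₁ t₀ G →
        BoundedGradientVariance T (nodeLoss net act φ Γ X y) w₁ t₀ σ₀ →
        -- learning rates, number of iterations, confidence
        max ((2 * P) ^ (1 / α)) 1 ≤ t₀ → 2 ≤ T → 0 < δ → δ < 1 →
        -- the quantities on which the constant depends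
        holderConst (nodeLoss net act φ Γ X y) α w₁ r ≤ PF →
        (∀ i, |nodeLoss net act φ Γ X y i w₁| ≤ b) →
        L₀ ≤ lipschitzConst (nodeLoss net act φ Γ X y) w₁ r →
        (α < 1 / 2 →
          1 - δ ≤ prob {ω : Outcome m u T | genGap (nodeLoss net act φ Γ X y) w₁ t₀ ω ≤
            C * (lipschitzConst (nodeLoss net act φ Γ X y) w₁ r *
              (((m : ℝ) + u) ^ (3 / 2 : ℝ) / ((m : ℝ) * u)) *
              Real.log T ^ (1 / 2 : ℝ) * (T : ℝ) ^ ((1 - 2 * α) / 2) * Real.log (2 / δ))}) ∧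
        (α = 1 / 2 →
          1 - δ ≤ prob {ω : Outcome m u T | genGap (nodeLoss net act φ Γ X y) w₁ t₀ ω ≤
            C * (lipschitzConst (nodeLoss net act φ Γ X y) w₁ r *
              (((m : ℝ) + u) ^ (3 / 2 : ℝ) / ((m : ℝ) * u)) *
              Real.log T * Real.log (2 / δ))}) ∧
        (1 / 2 < α →
          1 - δ ≤ prob {ω : Outcome m u T | genGap (nodeLoss net act φ Γ X y) w₁ t₀ ω ≤
            C * (lipschitzConst (nodeLoss net act φ Γ X y) w₁ r *
              (((m : ℝ) + u) ^ (3 / 2 : ℝ) / ((m : ℝ) * u)) *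
              Real.log T ^ (1 / 2 : ℝ) * Real.log (2 / δ))}) := by
  have hg0 := gapConst_pos D (α := α) (PF := PF) (σ₀ := σ₀) hG hb hL₀
  refine ⟨2 * gapConst D α PF G σ₀ b L₀, by positivity, ?_⟩
  intro 𝒴 H d₀ k p q net act φ m u _ _ Γ X y w₁ r cX cW P t₀ δ T hD hr _ _ _ _ hball hP hact hactH
    hgrad hvar ht₀ hT hδ hδ1 hPF' hℓb hL
  have hsmooth := isHolderC1_nodeLoss hα.le hα1 (convex_closedBall w₁ r)
    Metric.isBounded_closedBall hP.le hact hactH net φ Γ X y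
  have hcard : Fintype.card (ParamIdx p q) ≤ D := by
    simpa [ParamIdx, Fintype.card_sigma] using hD
  have ht₀' : 1 ≤ t₀ := (le_max_right _ _).trans ht₀
  have hT' : (2 : ℝ) ≤ T := by exact_mod_cast hT
  have hlogT : 1 / 2 ≤ Real.log T := by
    have h1 : Real.log 2 ≤ Real.log T := Real.log_le_log (by norm_num) hT'
    linarith [Real.log_two_gt_d9]
  have hΛ := half_le_log_two_div hδ hδ1
  have hΦ : 0 < sizeFactor m u := sizeFactor_pos
  have hL0 := hL₀.trans_le hL
  have key := prob_genGap_le hcard hα hα1 hPF hG hb.le (zero_le_one.trans hr) hL₀ hL ht₀' hT hδ hδ1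
    (fun i => (hsmooth i).1) (fun i w => φ.nonneg _ _) hℓb
    (fun i w hw w' hw' => abs_sub_le_lipschitzConst hL0 i hw hw')
    (fun i w hw w' hw' => (norm_gradient_sub_le_holderConst hsmooth i hw hw').trans
      (mul_le_mul_of_nonneg_right hPF' (le_max_of_le_right (norm_nonneg _)))) hball hgrad hvar
  change _ ∧ _ ∧ _
  set L := lipschitzConst (nodeLoss net act φ Γ X y) w₁ r
  have hmono : ∀ B : ℝ, √(Real.log T) ≤ 2 * B → 1 - δ ≤ prob {ω : Outcome m u T |
      genGap (nodeLoss net act φ Γ X y) w₁ t₀ ω ≤ 2 * gapConst D α PF G σ₀ b L₀ *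
        (L * sizeFactor m u * B * Real.log (2 / δ))} := fun B hB => by
    refine key.trans (prob_mono fun ω hω => (show genGap _ _ _ _ ≤ _ from hω).trans ?_)
    calc _ ≤ gapConst D α PF G σ₀ b L₀ *
          (L * sizeFactor m u * (2 * B) * Real.log (2 / δ)) := by gcongr
      _ = _ := by ring
  have hs := half_le_sqrt hlogT
  refine ⟨fun hα2 => ?_, fun _ => ?_, fun _ => ?_⟩
  · have h := hmono (√(Real.log T) * (T : ℝ) ^ ((1 - 2 * α) / 2)) (by
      have h1 : 1 ≤ (T : ℝ) ^ ((1 - 2 * α) / 2) :=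
        Real.one_le_rpow (by linarith) (by linarith)
      nlinarith)
    rw [Real.sqrt_eq_rpow, ← mul_assoc (L * sizeFactor m u)] at h
    exact h
  · exact hmono (Real.log T) (by
      have h1 : √(Real.log T) * √(Real.log T) = Real.log T := Real.mul_self_sqrt (by linarith)
      nlinarith)
  · have h := hmono (√(Real.log T)) (by linarith)
    rw [Real.sqrt_eq_rpow] at h
    exact h
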